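/- A set partition of $[n]=\{1,\dots,n\}$ ($n\ge 0$) is represented by its canonical sequence $\pi=\pi_1\pi_2\cdots\pi_n$, where $\pi_j$ is the index of the block containing $j$ when the blocks are ordered by their minima; $n$ is the size of $\pi$. A partition $\pi$ contains a partition (pattern) $\tau$ if some subsequence of $\pi$ is order-isomorphic to $\tau$; otherwise $\pi$ avoids $\tau$. A partition is non-crossing if there are no $i<j<k<l$ with $i,k$ in one block and $j,l$ in another; equivalently, if it avoids $1212$. When $[\tau]$ is written as a part of a longer sequence, it stands for the sequence obtained from $\tau$ by adding to each of its terms the number of distinct symbols that appear before it; for example, $1[112]1=12231$. A partition is connected if it cannot be written as $\alpha[\beta]$ with nonempty partitions $\alpha,\beta$. Every partition $\pi$ can be written uniquely as $\pi=\alpha_1[\alpha_2]\cdots[\alpha_m]$ with nonempty connected partitions $\alpha_1,\dots,\alpha_m$, called the components of $\pi$. Two non-crossing partitions $\tau,\tau'$ are cc-equivalent if there is a bijection from the set of $(1212,\tau)$-avoiding partitions to the set of $(1212,\tau')$-avoiding partitions that preserves the size and the number of components. **Theorem.** Let $\sigma_1,\dots,\sigma_k$ be (possibly empty) non-crossing partitions,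 and let $1\le q<k$ be such that $\sigma_q$ is empty, or connected, or contains only singleton blocks. Then the partition $$\sigma=1[\sigma_1]1[\sigma_2]1\cdots1[\sigma_{q-1}]1[\sigma_q]1[\sigma_{q+1}]1[\sigma_{q+2}]1\cdots1[\sigma_k]1$$ is cc-equivalent to $$\sigma'=1[\sigma_1]1[\sigma_2]1\cdots1[\sigma_{q-1}]1[\sigma_{q+1}]1[\sigma_q]1[\sigma_{q+2}]1\cdots1[\sigma_k]1 .$$ -/

import Mathlib

namespace SetPart

/-- A finite set partition of `{1, …, n}`, given by its canonical sequence `w₁ w₂ … wₙ`, where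
`w_j` is the index of the block that contains `j` when the blocks are ordered by their minima.
These are the restricted growth sequences: the first letter is `1`, the letters are positive and
each letter exceeds the maximum of the preceding ones by at most one.
The empty list is the unique partition of size `0`. -/
def IsPartition (w : List ℕ) : Prop :=
  ∀ (i : ℕ) (hi : i < w.length), 1 ≤ w[i] ∧ w[i] ≤ (w.take i).foldr max 0 + 1

/-- The number of distinct letters of a sequence, i.e. the number of blocks of a partition. -/
def numBlocks (w : List ℕ) : ℕ := w.toFinset.card

/-- `w` contains the pattern `p`: some subsequence of `w` is order-isomorphic to `p`. -/
def Contains (w p : List ℕ) : Prop :=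
  ∃ f : Fin p.length → Fin w.length, StrictMono f ∧
    ∀ i j, w.get (f i) < w.get (f j) ↔ p.get i < p.get j

/-- `w` avoids the pattern `p`. -/
def Avoids (w p : List ℕ) : Prop := ¬ Contains w p

/-- There are no positions `i < j < k < l` such that `i, k` are in one block and `j, l` are in
another one. -/
def NonCrossing (w : List ℕ) : Prop :=
  ¬ ∃ i j k l : Fin w.length, i < j ∧ j < k ∧ k < l ∧
    w.get i = w.get k ∧ w.get j = w.get l ∧ w.get i ≠ w.get j

/-- All the blocks are singletons, i.e. no letter is repeated. -/
def OnlySingletons (w : List ℕ) : Prop := w.Nodup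

/-- `p[s]`: the sequence `p` followed by `s`, with `s` shifted up by the number of distinct
letters of `p`. -/
def bracket (p s : List ℕ) : List ℕ := p ++ s.map (· + numBlocks p)

/-- `1[s₁]1[s₂]1⋯1[s_k]1`, for a list `s₁, …, s_k` of sequences. -/
def chain (L : List (List ℕ)) : List ℕ := L.foldl (fun p s => bracket p s ++ [1]) [1]

/-- `s₁[s₂][s₃]⋯[s_m]`, for a list `s₁, …, s_m` of sequences. -/
def bracketAll (L : List (List ℕ)) : List ℕ := L.foldl bracket []

/-- `w` cannot be written as `s[t]` with nonempty partitions `s` and `t`. -/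
def Connected (w : List ℕ) : Prop :=
  ¬ ∃ s t : List ℕ, IsPartition s ∧ IsPartition t ∧ s ≠ [] ∧ t ≠ [] ∧ w = bracket s t

/-- `L` is the sequence of components of the partition `w`; by `existsUnique_components` below,
each partition has exactly one. -/
def IsComponents (w : List ℕ) (L : List (List ℕ)) : Prop :=
  (∀ s ∈ L, IsPartition s ∧ s ≠ [] ∧ Connected s) ∧ bracketAll L = w

/-- The set of `(1212, p)`-avoiding partitions, of all sizes. -/
def ncAvoiders (p : List ℕ) : Set (List ℕ) :=
  {w | IsPartition w ∧ Avoids w [1, 2, 1, 2] ∧ Avoids w p}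

/-- The two sequences are non-crossing partitions, and there is a bijection from the
`(1212, p)`-avoiding partitions to the `(1212, q)`-avoiding partitions that preserves the size
and the number of components. -/
def CCEquiv (p q : List ℕ) : Prop :=
  (IsPartition p ∧ NonCrossing p) ∧ (IsPartition q ∧ NonCrossing q) ∧
    ∃ f : ncAvoiders p ≃ ncAvoiders q, ∀ w : ncAvoiders p,
      (f w).1.length = w.1.length ∧
      ∃ L M, IsComponents w.1 L ∧ IsComponents (f w).1 M ∧ M.length = L.length

/-! Existence and uniqueness of the components. -/

theorem foldr_max_append (u v : List ℕ) :
    (u ++ v).foldr max 0 = max (u.foldr max 0) (v.foldr max 0) := by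
  induction u with
  | nil => simp
  | cons a u ih => simp [ih, max_assoc]

theorem isPartition_nil : IsPartition [] := fun i hi => absurd hi (by simp)

theorem isPartition_snoc {w : List ℕ} {a : ℕ} :
    IsPartition (w ++ [a]) ↔ IsPartition w ∧ 1 ≤ a ∧ a ≤ w.foldr max 0 + 1 := by
  constructor
  · intro h
    refine ⟨fun i hi => ?_, ?_⟩
    · have := h i (by simp; omega)
      rwa [List.getElem_append_left hi, List.take_append_of_le_length hi.le] at this
    · have := h w.length (by simp)
      simpa using this
  · rintro ⟨h, ha⟩ i hi
    rcases Nat.lt_or_ge i w.length with h' | h'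
    · rw [List.getElem_append_left h', List.take_append_of_le_length h'.le]
      exact h i h'
    · obtain rfl : i = w.length := by simp at hi; omega
      simpa using ha

theorem IsPartition.take {w : List ℕ} (h : IsPartition w) (n : ℕ) : IsPartition (w.take n) := by
  intro i hi
  have hi' : i < n ∧ i < w.length := by simpa using hi
  have := h i hi'.2
  rw [List.getElem_take, List.take_take, min_eq_left hi'.1.le]
  exact this

theorem IsPartition.toFinset_eq {w : List ℕ} (h : IsPartition w) :
    w.toFinset = Finset.Icc 1 (w.foldr max 0) := by
  induction w using List.reverseRecOn with
  | nil => simp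
  | append_singleton w a ih =>
    obtain ⟨hw, h1, h2⟩ := isPartition_snoc.1 h
    rw [List.toFinset_append, ih hw, foldr_max_append]
    ext x
    simp
    omega

theorem IsPartition.foldr_max {w : List ℕ} (h : IsPartition w) :
    w.foldr max 0 = numBlocks w := by
  simp [numBlocks, h.toFinset_eq]

theorem IsPartition.mem_iff {w : List ℕ} (h : IsPartition w) {x : ℕ} :
    x ∈ w ↔ 1 ≤ x ∧ x ≤ numBlocks w := by
  rw [← List.mem_toFinset, h.toFinset_eq, h.foldr_max, Finset.mem_Icc]

theorem numBlocks_bracket {s t : List ℕ} (hs : IsPartition s) (ht : IsPartition t) :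
    numBlocks (bracket s t) = numBlocks s + numBlocks t := by
  have e : (bracket s t).toFinset = Finset.Icc 1 (numBlocks s + numBlocks t) := by
    ext x
    simp only [bracket, List.mem_toFinset, List.mem_append, List.mem_map, hs.mem_iff, ht.mem_iff,
      Finset.mem_Icc]
    constructor
    · rintro (h | ⟨y, h, rfl⟩) <;> omega
    · intro h
      by_cases hx : x ≤ numBlocks s
      · exact Or.inl ⟨h.1, hx⟩
      · exact Or.inr ⟨x - numBlocks s, by omega, by omega⟩
  rw [numBlocks, e]
  simp

theorem IsPartition.bracket {s t : List ℕ} (hs : IsPartition s) (ht : IsPartition t) :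
    IsPartition (bracket s t) := by
  induction t using List.reverseRecOn with
  | nil => simpa [SetPart.bracket] using hs
  | append_singleton t a ih =>
    obtain ⟨ht', h1, h2⟩ := isPartition_snoc.1 ht
    have e : SetPart.bracket s (t ++ [a]) = SetPart.bracket s t ++ [a + numBlocks s] := by
      simp [SetPart.bracket]
    rw [e, isPartition_snoc]
    refine ⟨ih ht', by omega, ?_⟩
    rw [(ih ht').foldr_max, numBlocks_bracket hs ht', ← ht'.foldr_max]
    omega

theorem bracket_assoc {r s : List ℕ} (t : List ℕ) (hr : IsPartition r) (hs : IsPartition s) :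
    bracket (bracket r s) t = bracket r (bracket s t) := by
  have := numBlocks_bracket hr hs
  rw [bracket, this]
  simp [bracket, Function.comp_def]
  intros
  omega

theorem nil_bracket (t : List ℕ) : bracket [] t = t := by simp [bracket, numBlocks]

theorem bracketAll_spec (L : List (List ℕ)) (hL : ∀ s ∈ L, IsPartition s) :
    IsPartition (bracketAll L) ∧
      ∀ r, IsPartition r → L.foldl bracket r = bracket r (bracketAll L) := by
  induction L using List.reverseRecOn with
  | nil => exact ⟨isPartition_nil, fun r _ => by simp [bracketAll, bracket]⟩
  | append_singleton L a ih =>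
    have ha := hL a (by simp)
    obtain ⟨h1, h2⟩ := ih fun s hs => hL s (by simp [hs])
    have e : bracketAll (L ++ [a]) = bracket (bracketAll L) a := by
      simp [bracketAll, List.foldl_append]
    refine ⟨e ▸ h1.bracket ha, fun r hr => ?_⟩
    rw [e, ← bracket_assoc a hr h1, ← h2 r hr]
    simp [List.foldl_append]

theorem bracketAll_cons (s : List ℕ) (L : List (List ℕ)) (hs : IsPartition s)
    (hL : ∀ s ∈ L, IsPartition s) : bracketAll (s :: L) = bracket s (bracketAll L) := by
  rw [← (bracketAll_spec L hL).2 s hs]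
  simp [bracketAll, nil_bracket]

theorem exists_components (w : List ℕ) (hw : IsPartition w) : ∃ L, IsComponents w L := by
  induction h : w.length using Nat.strong_induction_on generalizing w with
  | _ n ih =>
    by_cases h0 : w = []
    · exact ⟨[], by simp, by simp [bracketAll, h0]⟩
    by_cases hc : Connected w
    · exact ⟨[w], by simp [hw, h0, hc], by simp [bracketAll, nil_bracket]⟩
    obtain ⟨s, t, hs, ht, hs0, ht0, rfl⟩ := not_not.1 hc
    have l1 := List.length_pos_of_ne_nil hs0
    have l2 := List.length_pos_of_ne_nil ht0
    have l3 : s.length + t.length = n := by simpa [bracket] using h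
    obtain ⟨L, hL, eL⟩ := ih s.length (by omega) s hs rfl
    obtain ⟨M, hM, eM⟩ := ih t.length (by omega) t ht rfl
    refine ⟨L ++ M, fun r hr => (List.mem_append.1 hr).elim (hL r) (hM r), ?_⟩
    rw [← eM, ← (bracketAll_spec M fun r hr => (hM r hr).1).2 s hs, ← eL]
    simp [bracketAll, List.foldl_append]

theorem eq_of_bracket_eq {s s' t t' : List ℕ} (hs : IsPartition s) (hs0 : s ≠ [])
    (ht : IsPartition t) (hc : Connected s') (hl : s.length ≤ s'.length)
    (e : bracket s t = bracket s' t') : s = s' := by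
  have h1 : s' = (bracket s t).take s'.length := by rw [e]; simp [bracket]
  have h2 : s' = bracket s (t.take (s'.length - s.length)) := by
    rw [h1, bracket, List.take_append, List.take_of_length_le hl, ← List.map_take]
    simp [bracket]
  by_cases h0 : t.take (s'.length - s.length) = []
  · rw [h2, h0]; simp [bracket]
  · exact absurd ⟨s, _, hs, ht.take _, hs0, h0, h2⟩ hc

theorem components_unique (L : List (List ℕ)) : ∀ M w, IsComponents w L → IsComponents w M →
    L = M := by
  induction L with
  | nil =>
    rintro (_ | ⟨s, M⟩) w ⟨_, rfl⟩ ⟨hM, e⟩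
    · rfl
    · rw [bracketAll_cons s M (hM s (by simp)).1 fun r hr => (hM r (by simp [hr])).1] at e
      simp [bracketAll, bracket, (hM s (by simp)).2.1] at e
  | cons s L ih =>
    rintro (_ | ⟨s', M⟩) w ⟨hL, rfl⟩ ⟨hM, e⟩
    · rw [bracketAll_cons s L (hL s (by simp)).1 fun r hr => (hL r (by simp [hr])).1] at e
      have := congrArg List.length e
      have h := List.length_pos_of_ne_nil (hL s (by simp)).2.1
      simp [bracketAll, bracket] at this
      omega
    · have hL' : ∀ r ∈ L, IsPartition r := fun r hr => (hL r (by simp [hr])).1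
      have hM' : ∀ r ∈ M, IsPartition r := fun r hr => (hM r (by simp [hr])).1
      obtain ⟨a1, a2, a3⟩ := hL s (by simp)
      obtain ⟨b1, b2, b3⟩ := hM s' (by simp)
      rw [bracketAll_cons s L a1 hL', bracketAll_cons s' M b1 hM'] at e
      have hss : s = s' := by
        rcases le_total s.length s'.length with hl | hl
        · exact eq_of_bracket_eq a1 a2 (bracketAll_spec L hL').1 b3 hl e.symm
        · exact (eq_of_bracket_eq b1 b2 (bracketAll_spec M hM').1 a3 hl e).symm
      subst hss
      have e' : bracketAll M = bracketAll L := by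
        have := List.append_cancel_left e
        exact List.map_injective_iff.2 (fun x y h => by simpa using h) this
      rw [ih M (bracketAll L) ⟨fun r hr => hL r (by simp [hr]), rfl⟩
        ⟨fun r hr => hM r (by simp [hr]), e'⟩]

/-- Every partition has a unique sequence of components. -/
theorem existsUnique_components (w : List ℕ) (hw : IsPartition w) : ∃! L, IsComponents w L := by
  obtain ⟨L, hL⟩ := exists_components w hw
  exact ⟨L, hL, fun M hM => components_unique M L w hM hL⟩

/-- A partition is non-crossing if and only if it avoids the pattern `1212`. -/
theorem nonCrossing_iff (w : List ℕ) (hw : IsPartition w) :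
    NonCrossing w ↔ Avoids w [1, 2, 1, 2] := by
  refine not_congr ⟨?_, ?_⟩
  · have key : ∀ i j k l : Fin w.length, i < j → j < k → k < l → w.get i = w.get k →
        w.get j = w.get l → w.get i < w.get j → Contains w [1, 2, 1, 2] := by
      intro i j k l hij hjk hkl h1 h2 h3
      refine ⟨![i, j, k, l], ?_, ?_⟩
      · refine Fin.strictMono_iff_lt_succ.2 fun a => ?_
        fin_cases a
        · exact hij
        · exact hjk
        · exact hkl
      · intro a b
        have h4 : w.get k < w.get l := by omega
        fin_cases a <;> fin_cases b <;> simp at * <;> omega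
    rintro ⟨i, j, k, l, hij, hjk, hkl, h1, h2, h3⟩
    rcases lt_or_gt_of_ne h3 with h | h
    · exact key i j k l hij hjk hkl h1 h2 h
    · have hi := hw i i.2
      have hm : w.get j ∈ w.take i := by
        rw [(hw.take i).mem_iff, ← (hw.take i).foldr_max]
        have := hw j j.2
        simp only [List.get_eq_getElem] at *
        omega
      obtain ⟨m, hm, e⟩ := List.mem_iff_getElem.1 hm
      have hm' : m < i ∧ m < w.length := by
        have h5 : m < i.1 := by simpa using hm
        exact ⟨h5, h5.trans i.2⟩
      rw [List.getElem_take] at e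
      have e' : w.get ⟨m, hm'.2⟩ = w.get j := e
      exact key ⟨m, hm'.2⟩ i j k hm'.1 hij hjk e' h1 (by omega)
  · rintro ⟨f, hf, h⟩
    have h02 := h 0 2
    have h20 := h 2 0
    have h13 := h 1 3
    have h31 := h 3 1
    have h01 := h 0 1
    simp at h02 h20 h13 h31 h01
    refine ⟨f 0, f 1, f 2, f 3, hf (by simp), hf (by simp), hf (by simp), ?_, ?_, ?_⟩ <;>
      simp only [List.get_eq_getElem] <;> omega

end SetPart

/-! A nonempty connected non-crossing partition is `1[π₁]1⋯1[π_m]1` for a unique word `π₁⋯π_m` of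
smaller non-crossing partitions, so `decompose` identifies non-crossing partitions with lists of
words of such partitions, one word per component. The pattern begins and ends with the same letter,
hence an occurrence lies in one component. There it either lies inside some `π_i`, or sends its `1`s
to the outer `1`s. By `contains_chain_chain_iff` the latter means that the word lies in a product of
languages, where the `i`-th factor consists of the nonempty words whose bracketed concatenation
contains `σ_i`.

Swapping two adjacent patterns swaps two factors `a`, `b` of this product. All factors are
infix-closed, so a word in `a * b` can be cut after its shortest prefix in `a`, and reversing the
rest turns `b` into `b.reverse`. Reversing whole words then gives `b * a.reverse`, which is `b * a`
when `a` is closed under reversal. The condition on `σ_q` ensures exactly this closure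
(`reverse_containing`). The resulting bijection only permutes the letters of a word, so it preserves
sizes.

The avoidance condition also recurs into the letters, so the bijection is built by induction on size
in `exists_perm_of_rearranges`: rearrange each word, then replace its letters by their images. The
replacement must not disturb the product of languages. Partitions that miss some `σ_i` avoid both
patterns, so a counting argument (`exists_perm_fixing`) allows the replacement to fix them; the
other partitions contain every `σ_i`, and so do their images (`mapInvariant_containing`). -/

namespace SetPart

/-! ### Rearrangements of products of infix-closed languages. -/

/-- A language closed under passing to words that contain a given one as a factor. -/
def InfixClosed {α : Type*} (p : Language α) : Prop :=
  ∀ ⦃u⦄, u ∈ p → ∀ x y : List α, x ++ u ++ y ∈ p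

/-- Some bijection of the words that only rearranges letters maps `p` onto `q`. -/
def Rearranges {α : Type*} (p q : Language α) : Prop :=
  ∃ Φ : List α ≃ List α, (∀ u, (Φ u).Perm u) ∧ ∀ u, u ∈ p ↔ Φ u ∈ q

section Words

variable {α : Type*} {p q D D' a b : Language α}

theorem InfixClosed.mul (hp : InfixClosed p) (hq : InfixClosed q) : InfixClosed (p * q) := by
  intro w hw x y
  obtain ⟨u, hu, v, hv, rfl⟩ := Language.mem_mul.1 hw
  have h1 := hp hu x []
  have h2 := hq hv [] y
  exact Language.mem_mul.2 ⟨x ++ u, by simpa using h1, v ++ y, by simpa using h2, by simp⟩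

theorem infixClosed_top : InfixClosed (⊤ : Language α) := fun _ _ _ _ => trivial

theorem InfixClosed.reverse (hp : InfixClosed p) : InfixClosed p.reverse := by
  intro u hu x y
  have h := hp hu y.reverse x.reverse
  rw [Language.mem_reverse]
  simpa using h

theorem Rearranges.trans {r : Language α} (h : Rearranges p q) (h' : Rearranges q r) :
    Rearranges p r := by
  obtain ⟨Φ, h1, h2⟩ := h
  obtain ⟨Ψ, h3, h4⟩ := h'
  exact ⟨Φ.trans Ψ, fun u => (h3 _).trans (h1 u), fun u => (h2 u).trans (h4 _)⟩

theorem rearranges_reverse (p : Language α) : Rearranges p p.reverse :=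
  ⟨⟨List.reverse, List.reverse, List.reverse_reverse, List.reverse_reverse⟩,
    List.reverse_perm, fun u => by simp [Language.mem_reverse]⟩

/-- The length of the shortest prefix in `p`. -/
noncomputable def cutIndex (p : Language α) (u : List α) : ℕ := sInf {n | u.take n ∈ p}

/-- `P` belongs to `p`, and none of its proper prefixes does. -/
def IsMinimalPrefix (p : Language α) (P : List α) : Prop :=
  P ∈ p ∧ ∀ n < P.length, P.take n ∉ p

theorem IsMinimalPrefix.cutIndex_eq {P : List α} (h : IsMinimalPrefix p P) (R : List α) :
    cutIndex p (P ++ R) = P.length := by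
  refine le_antisymm (Nat.sInf_le (by simpa using h.1)) ?_
  refine le_csInf ⟨P.length, by simpa using h.1⟩ fun n hn => ?_
  by_contra! hlt
  refine h.2 n hlt ?_
  simpa [List.take_append_of_le_length hlt.le] using hn

theorem exists_isMinimalPrefix {u : List α} (hu : u ∈ p) :
    ∃ P R, IsMinimalPrefix p P ∧ u = P ++ R := by
  have hne : {n | u.take n ∈ p}.Nonempty := ⟨u.length, by simpa using hu⟩
  refine ⟨u.take (cutIndex p u), u.drop (cutIndex p u), ⟨Nat.sInf_mem hne, fun n hn hm => ?_⟩,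
    by simp⟩
  have hn' : n < cutIndex p u := by simp at hn; omega
  rw [List.take_take, min_eq_left hn'.le] at hm
  exact Nat.notMem_of_lt_sInf hn' hm

open Classical in
/-- Apply `Φ` to what follows the shortest prefix in `p`. -/
noncomputable def mapTail (p : Language α) (Φ : List α → List α) (u : List α) : List α :=
  -- Membership of `u` in `p` makes the set in `cutIndex` nonempty, so its infimum is attained.
  if u ∈ p then u.take (cutIndex p u) ++ Φ (u.drop (cutIndex p u)) else u

theorem mapTail_of_notMem (Φ : List α → List α) {u : List α} (hu : u ∉ p) :
    mapTail p Φ u = u := if_neg hu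

theorem InfixClosed.mem_append (hp : InfixClosed p) {P : List α} (h : P ∈ p) (R : List α) :
    P ++ R ∈ p := by simpa using hp h [] R

theorem mapTail_append (hp : InfixClosed p) (Φ : List α → List α) {P : List α}
    (h : IsMinimalPrefix p P) (R : List α) : mapTail p Φ (P ++ R) = P ++ Φ R := by
  rw [mapTail, if_pos (hp.mem_append h.1 R), h.cutIndex_eq]
  simp

theorem mapTail_mapTail (hp : InfixClosed p) {Φ Ψ : List α → List α} (h : ∀ u, Ψ (Φ u) = u)
    (u : List α) : mapTail p Ψ (mapTail p Φ u) = u := by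
  by_cases hu : u ∈ p
  · obtain ⟨P, R, hP, rfl⟩ := exists_isMinimalPrefix hu
    rw [mapTail_append hp _ hP, mapTail_append hp _ hP, h]
  · rw [mapTail_of_notMem _ hu, mapTail_of_notMem _ hu]

/-- In a factorization of `P ++ R` the first factor cannot be a proper prefix of `P`, by minimality.
So the second factor is a suffix of `R`, and infix-closure of `D` passes membership on to `R`. -/
theorem append_mem_mul_iff (hD : InfixClosed D) {P : List α}
    (h : IsMinimalPrefix p P) (R : List α) : P ++ R ∈ p * D ↔ R ∈ D := by
  refine ⟨?_, fun hR => ⟨P, h.1, R, hR, rfl⟩⟩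
  intro hw
  obtain ⟨I, hI, J, hJ, e⟩ := Language.mem_mul.1 hw
  rcases List.append_eq_append_iff.1 e with ⟨C, rfl, rfl⟩ | ⟨C, rfl, rfl⟩
  · rcases C.eq_nil_or_concat' with rfl | ⟨C, c, rfl⟩
    · simpa using hJ
    · exact absurd hI fun hI => h.2 I.length (by simp) (by simpa using hI)
  · simpa using hD hJ C []

theorem mem_of_mem_mul_left (hp : InfixClosed p) {u : List α} (h : u ∈ p * D) : u ∈ p := by
  obtain ⟨I, hI, J, -, rfl⟩ := h
  exact hp.mem_append hI J

/-- Only what follows the shortest prefix in `p` is rearranged. The prefix stays in place, so the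
cut can be recovered and the map inverted. -/
theorem Rearranges.mul_left (hp : InfixClosed p) (hD : InfixClosed D) (hD' : InfixClosed D')
    (h : Rearranges D D') : Rearranges (p * D) (p * D') := by
  obtain ⟨Φ, h1, h2⟩ := h
  refine ⟨⟨mapTail p Φ, mapTail p Φ.symm, mapTail_mapTail hp Φ.symm_apply_apply,
    mapTail_mapTail hp Φ.apply_symm_apply⟩, fun u => ?_, fun u => ?_⟩ <;>
    simp only [Equiv.coe_fn_mk] <;> by_cases hu : u ∈ p
  · obtain ⟨P, R, hP, rfl⟩ := exists_isMinimalPrefix hu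
    rw [mapTail_append hp _ hP]
    exact (h1 R).append_left P
  · rw [mapTail_of_notMem _ hu]
  · obtain ⟨P, R, hP, rfl⟩ := exists_isMinimalPrefix hu
    rw [mapTail_append hp _ hP, append_mem_mul_iff hD hP, append_mem_mul_iff hD' hP, h2]
  · rw [mapTail_of_notMem _ hu]
    exact iff_of_false (fun h => hu (mem_of_mem_mul_left hp h))
      fun h => hu (mem_of_mem_mul_left hp h)

theorem Rearranges.reverse (h : Rearranges p q) : Rearranges p.reverse q.reverse := by
  have h1 := rearranges_reverse p.reverse
  rw [Language.reverse_reverse] at h1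
  exact (h1.trans h).trans (rearranges_reverse q)

theorem Rearranges.mul_right (hp : InfixClosed p) (hD : InfixClosed D) (hD' : InfixClosed D')
    (h : Rearranges D D') : Rearranges (D * p) (D' * p) := by
  have h1 := (h.reverse.mul_left hp.reverse hD.reverse hD'.reverse).reverse
  simpa only [Language.reverse_mul, Language.reverse_reverse] using h1

/-- Two reversals: of the tail, `a * b` to `a * b.reverse`, and of the whole word, to `b * a.reverse
= b * a`. -/
theorem rearranges_mul_comm (ha : InfixClosed a) (hb : InfixClosed b) (h : a.reverse = a) :
    Rearranges (a * b) (b * a) := by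
  have h1 := (rearranges_reverse b).mul_left ha hb hb.reverse
  refine h1.trans ?_
  have h2 := rearranges_reverse (a * b.reverse)
  rwa [Language.reverse_mul, Language.reverse_reverse, h] at h2

theorem Rearranges.mul_prod_right {l : List (Language α)} (hl : ∀ p ∈ l, InfixClosed p)
    (hD : InfixClosed D) (hD' : InfixClosed D') (h : Rearranges D D') :
    Rearranges (D * l.prod) (D' * l.prod) := by
  induction l generalizing D D' with
  | nil => simpa using h
  | cons p l ih =>
    have hp := hl p (by simp)
    rw [List.prod_cons, ← mul_assoc, ← mul_assoc]
    exact ih (fun q hq => hl q (by simp [hq])) (hD.mul hp) (hD'.mul hp) (h.mul_right hp hD hD')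

/-- The extra factor `D` is needed because the empty product, which contains only the empty word, is
not infix-closed. -/
theorem InfixClosed.mul_prod {l : List (Language α)} (hl : ∀ p ∈ l, InfixClosed p)
    (hD : InfixClosed D) : InfixClosed (D * l.prod) := by
  induction l generalizing D with
  | nil => simpa using hD
  | cons p l ih =>
    rw [List.prod_cons, ← mul_assoc]
    exact ih (fun q hq => hl q (by simp [hq])) (hD.mul (hl p (by simp)))

theorem rearranges_prod_swap {l m : List (Language α)} (hl : ∀ p ∈ l, InfixClosed p)
    (hm : ∀ p ∈ m, InfixClosed p) (ha : InfixClosed a) (hb : InfixClosed b)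
    (h : a.reverse = a) :
    Rearranges (⊤ * (l ++ a :: b :: m).prod) (⊤ * (l ++ b :: a :: m).prod) := by
  have hT := infixClosed_top.mul_prod hl
  have h1 := (rearranges_mul_comm ha hb h).mul_left hT (ha.mul hb) (hb.mul ha)
  have h2 := h1.mul_prod_right hm (hT.mul (ha.mul hb)) (hT.mul (hb.mul ha))
  simpa only [List.prod_append, List.prod_cons, mul_assoc] using h2

/-- Membership in `p` is not affected by applying `e` to all letters. -/
def MapInvariant (e : α ≃ α) (p : Language α) : Prop := ∀ u, u.map e ∈ p ↔ u ∈ p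

theorem MapInvariant.mul {e : α ≃ α} (hp : MapInvariant e p) (hq : MapInvariant e q) :
    MapInvariant e (p * q) := by
  intro u
  constructor
  · rintro ⟨I, hI, J, hJ, h⟩
    obtain ⟨I, J, rfl, rfl, rfl⟩ := List.map_eq_append_iff.1 h.symm
    exact ⟨I, (hp I).1 hI, J, (hq J).1 hJ, rfl⟩
  · rintro ⟨I, hI, J, hJ, rfl⟩
    exact ⟨_, (hp I).2 hI, _, (hq J).2 hJ, by simp⟩

theorem mapInvariant_top (e : α ≃ α) : MapInvariant e (⊤ : Language α) := fun _ => Iff.rfl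

theorem MapInvariant.mul_prod {e : α ≃ α} {l : List (Language α)}
    (hl : ∀ p ∈ l, MapInvariant e p) (hD : MapInvariant e D) : MapInvariant e (D * l.prod) := by
  induction l generalizing D with
  | nil => simpa using hD
  | cons p l ih =>
    rw [List.prod_cons, ← mul_assoc]
    exact ih (fun q hq => hl q (by simp [hq])) (hD.mul (hl p (by simp)))

end Words

/-! ### Size-preserving bijections built along a recursive decomposition. -/

section Counting

variable {N : Type*}

/-- Glue permutations that preserve `size`, using the `n`-th one in size `n`. -/
def glueBySize (size : N → ℕ) (h : ℕ → Equiv.Perm N) (hs : ∀ n w, size (h n w) = size w) :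
    Equiv.Perm N where
  toFun w := h (size w) w
  invFun w := (h (size w)).symm w
  left_inv w := by simp [hs]
  right_inv w := by
    have : size ((h (size w)).symm w) = size w := by
      rw [← hs (size w) ((h (size w)).symm w), Equiv.apply_symm_apply]
    simp [this]

/-- A permutation of a finite level set that carries `A` to `A'` can be chosen to fix all elements
outside `F`, provided that these belong to both `A` and `A'`. -/
theorem exists_perm_fixing {size : N → ℕ} {A A' F : N → Prop} {n : ℕ}
    (hfin : {w | size w = n}.Finite) (hA : ∀ w, ¬ F w → A w) (hA' : ∀ w, ¬ F w → A' w)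
    (h : Equiv.Perm N) (hs : ∀ w, size (h w) = size w)
    (hh : ∀ w, size w = n → (A w ↔ A' (h w))) :
    ∃ e : Equiv.Perm N, (∀ w, size (e w) = size w) ∧ (∀ w, ¬ F w → e w = w) ∧
      ∀ w, size w = n → (A w ↔ A' (e w)) := by
  classical
  have img : h '' {w | size w = n ∧ A w} = {w | size w = n ∧ A' w} := by
    ext w
    constructor
    · rintro ⟨v, ⟨h1, h2⟩, rfl⟩
      exact ⟨(hs v).trans h1, (hh v h1).1 h2⟩
    · rintro ⟨h1, h2⟩
      have h3 : size (h.symm w) = n := by rw [← hs, Equiv.apply_symm_apply, h1]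
      exact ⟨h.symm w, ⟨h3, (hh _ h3).2 (by simpa using h2)⟩, by simp⟩
  have c1 : {w | size w = n ∧ A' w}.ncard = {w | size w = n ∧ A w}.ncard := by
    rw [← img, Set.ncard_image_of_injective _ h.injective]
  have f0 : {w | size w = n ∧ ¬ F w}.Finite := hfin.subset fun w hw => hw.1
  -- Everything outside `F` belongs to both classes, so removing it takes away the same number from
  -- each.
  have sub : ∀ B : N → Prop, (∀ w, ¬ F w → B w) →
      {w | size w = n ∧ F w ∧ B w}.ncard =
        {w | size w = n ∧ B w}.ncard - {w | size w = n ∧ ¬ F w}.ncard := by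
    intro B hB
    have hsub : {w | size w = n ∧ ¬ F w} ⊆ {w | size w = n ∧ B w} :=
      fun w hw => ⟨hw.1, hB w hw.2⟩
    rw [← Set.ncard_sdiff hsub f0]
    congr 1
    ext w
    simp only [Set.mem_ofPred_eq, Set.mem_sdiff]
    tauto
  have c2 : {w | size w = n ∧ F w ∧ A w}.ncard = {w | size w = n ∧ F w ∧ A' w}.ncard := by
    rw [sub A hA, sub A' hA', c1]
  let T := {w : N // size w = n ∧ F w}
  have : Finite T := (hfin.subset fun w hw => hw.1 : {w | size w = n ∧ F w}.Finite)
  have card : ∀ B : N → Prop,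
      Nat.card {w : T // B w.1} = {w | size w = n ∧ F w ∧ B w}.ncard := by
    intro B
    rw [← Nat.card_coe_set_eq]
    exact Nat.card_congr ((Equiv.subtypeSubtypeEquivSubtypeInter _ _).trans
      (Equiv.subtypeEquivRight fun w => by simp [and_assoc]))
  -- Equal cardinalities give a bijection inside the finite set `T`; it extends to a permutation of
  -- `T`, and then by the identity to all of `N`.
  obtain ⟨e0⟩ : Nonempty ({w : T // A w.1} ≃ {w : T // A' w.1}) :=
    Finite.card_eq.1 (by rw [card, card, c2])
  let e1 : Equiv.Perm T := e0.extendSubtype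
  have key : ∀ w (hw : size w = n ∧ F w), Equiv.Perm.ofSubtype e1 w = e1 ⟨w, hw⟩ :=
    fun w hw => Equiv.Perm.ofSubtype_apply_of_mem e1 hw
  have key' : ∀ w, ¬ (size w = n ∧ F w) → Equiv.Perm.ofSubtype e1 w = w :=
    fun w hw => Equiv.Perm.ofSubtype_apply_of_not_mem e1 hw
  refine ⟨Equiv.Perm.ofSubtype e1, fun w => ?_, fun w hw => key' w fun h => hw h.2,
    fun w hw => ?_⟩
  · by_cases hw : size w = n ∧ F w
    · rw [key w hw, (e1 ⟨w, hw⟩).2.1, hw.1]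
    · rw [key' w hw]
  · by_cases hF : F w
    · rw [key w ⟨hw, hF⟩]
      by_cases ha : A w
      · exact iff_of_true ha (e0.extendSubtype_mem ⟨w, hw, hF⟩ ha)
      · exact iff_of_false ha (e0.extendSubtype_not_mem ⟨w, hw, hF⟩ ha)
    · rw [key' w fun h => hF h.2]
      exact iff_of_true (hA w hF) (hA' w hF)

/-- Two hereditary classes of a recursively decomposed structure are equinumerous in each size and
number of components, when their forbidden words `S` and `S'` of parts are rearrangements of each
other and `S'` only depends on the parts outside `F`. -/
theorem exists_perm_of_rearranges {size : N → ℕ} (dec : N ≃ List (List N))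
    (hsize : ∀ w, size w = ((dec w).map fun u => 1 + (u.map fun v => 1 + size v).sum).sum)
    (hfin : ∀ n, {w | size w = n}.Finite) {A A' F : N → Prop} {S S' : Language N}
    (hA : ∀ w, A w ↔ ∀ u ∈ dec w, u ∉ S ∧ ∀ v ∈ u, A v)
    (hA' : ∀ w, A' w ↔ ∀ u ∈ dec w, u ∉ S' ∧ ∀ v ∈ u, A' v)
    (hS : Rearranges S S') (hF : ∀ w, ¬ F w → A w) (hF' : ∀ w, ¬ F w → A' w)
    (hinv : ∀ e : Equiv.Perm N, (∀ w, ¬ F w → e w = w) → MapInvariant e S') :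
    ∃ e : Equiv.Perm N, (∀ w, size (e w) = size w) ∧
      (∀ w, (dec (e w)).length = (dec w).length) ∧ ∀ w, A w ↔ A' (e w) := by
  obtain ⟨Φ, hΦ, hΦS⟩ := hS
  have main : ∀ n, ∃ e : Equiv.Perm N, (∀ w, size (e w) = size w) ∧
      (∀ w, (dec (e w)).length = (dec w).length) ∧ ∀ w, size w = n → (A w ↔ A' (e w)) := by
    intro n
    induction n using Nat.strong_induction_on with
    | _ n ih =>
      -- In sizes below `n` the inductive permutation is replaced by one fixing everything outside
      -- `F`; in the other sizes the identity serves.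
      have h1 : ∀ m, ∃ e : Equiv.Perm N, (∀ w, size (e w) = size w) ∧
          (∀ w, ¬ F w → e w = w) ∧ (m < n → ∀ w, size w = m → (A w ↔ A' (e w))) := by
        intro m
        by_cases hm : m < n
        · obtain ⟨h, a1, -, a3⟩ := ih m hm
          obtain ⟨e, b1, b2, b3⟩ := exists_perm_fixing (hfin m) hF hF' h a1 a3
          exact ⟨e, b1, b2, fun _ => b3⟩
        · exact ⟨1, fun _ => rfl, fun _ _ => rfl, fun h => absurd h hm⟩
      choose e e1 e2 e3 using h1
      let g := glueBySize size e e1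
      have g1 : ∀ w, size (g w) = size w := fun w => e1 _ w
      have g2 : ∀ w, ¬ F w → g w = w := fun w => e2 _ w
      have g3 : ∀ w, size w < n → (A w ↔ A' (g w)) := fun w hw => e3 _ hw w rfl
      let φ : List N → List N := fun u => (Φ u).map g
      let E : Equiv.Perm N :=
        (dec.trans (Equiv.listEquivOfEquiv (Φ.trans (Equiv.listEquivOfEquiv g)))).trans dec.symm
      have hE : ∀ w, dec (E w) = (dec w).map φ := fun w => by simp [E, φ]; rfl
      refine ⟨E, fun w => ?_, fun w => by rw [hE, List.length_map], fun w hw => ?_⟩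
      · rw [hsize, hsize w, hE, List.map_map]
        congr 2
        ext u
        simp only [Function.comp_apply, φ, List.map_map]
        congr 1
        have : ((fun v => 1 + size v) ∘ g) = fun v => 1 + size v := by ext v; simp [g1]
        rw [this]
        exact ((hΦ u).map _).sum_eq
      · rw [hA, hA', hE, List.forall_mem_map]
        refine forall₂_congr fun u hu => and_congr (not_congr ?_) ?_
        -- `Φ` carries `S` to `S'`, and relabelling the letters by `g` does not change membership in
        -- `S'`.
        · rw [hΦS, ← hinv g g2]
        · simp only [φ, List.forall_mem_map, (hΦ u).mem_iff]
          refine forall₂_congr fun v hv => g3 v ?_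
          -- The summands `1` make the letters of `u` strictly smaller than `w`, so the inductive
          -- property of `g` applies to them.
          have l1 : 1 + (u.map fun v => 1 + size v).sum ≤ size w := by
            rw [hsize]
            exact List.le_sum_of_mem (List.mem_map_of_mem hu)
          have l2 : 1 + size v ≤ (u.map fun v => 1 + size v).sum :=
            List.le_sum_of_mem (List.mem_map_of_mem (f := fun v => 1 + size v) hv)
          omega
  choose e e1 e2 e3 using main
  exact ⟨glueBySize size e e1, fun w => e1 _ w, fun w => e2 _ w, fun w => e3 _ w rfl⟩

end Counting

/-! ### Pattern containment through monotone maps of letters. -/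

/-- An order isomorphism of positions sends equal letters to equal letters, so it induces a map on
letters. This form replaces index arithmetic by reasoning about sublists. -/
theorem contains_iff {w p : List ℕ} :
    Contains w p ↔ ∃ g : ℕ → ℕ, StrictMonoOn g {x | x ∈ p} ∧ (p.map g).Sublist w := by
  constructor
  · rintro ⟨f, hf, h⟩
    have heq : ∀ i j, p.get i = p.get j → w.get (f i) = w.get (f j) := by
      intro i j e
      have h1 := h i j
      have h2 := h j i
      omega
    have hex : ∀ x : ℕ, ∃ y, ∀ i, p.get i = x → w.get (f i) = y := by
      intro x
      by_cases hx : ∃ i, p.get i = x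
      · obtain ⟨i, hi⟩ := hx
        exact ⟨w.get (f i), fun j hj => heq _ _ (hj.trans hi.symm)⟩
      -- The value at a letter absent from `p` is arbitrary.
      · exact ⟨0, fun i hi => absurd ⟨i, hi⟩ hx⟩
    choose g hg using hex
    refine ⟨g, ?_, ?_⟩
    · intro x hx y hy hxy
      obtain ⟨i, rfl⟩ := List.mem_iff_get.1 hx
      obtain ⟨j, rfl⟩ := List.mem_iff_get.1 hy
      rw [← hg _ i rfl, ← hg _ j rfl]
      exact (h i j).2 hxy
    · refine List.sublist_iff_exists_fin_orderEmbedding_get_eq.2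
        ⟨(Fin.castOrderIso (by simp)).toOrderEmbedding.trans
          (OrderEmbedding.ofStrictMono f hf), fun i => ?_⟩
      have := hg _ (Fin.cast (by simp) i) rfl
      simpa using this.symm
  · rintro ⟨g, hg, hs⟩
    obtain ⟨f, hf⟩ := List.sublist_iff_exists_fin_orderEmbedding_get_eq.1 hs
    refine ⟨fun i => f (Fin.cast (by simp) i), fun i j hij => f.strictMono hij, fun i j => ?_⟩
    rw [← hf, ← hf]
    simp only [List.get_eq_getElem, List.getElem_map, Fin.val_cast]
    exact hg.lt_iff_lt (List.getElem_mem _) (List.getElem_mem _)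

theorem Contains.of_sublist {v w p : List ℕ} (h : Contains v p) (hs : v.Sublist w) :
    Contains w p := by
  obtain ⟨g, h1, h2⟩ := contains_iff.1 h
  exact contains_iff.2 ⟨g, h1, h2.trans hs⟩

theorem Contains.pattern_sublist {w p p' : List ℕ} (h : Contains w p) (hs : p'.Sublist p) :
    Contains w p' := by
  obtain ⟨g, h1, h2⟩ := contains_iff.1 h
  exact contains_iff.2 ⟨g, h1.mono fun x hx => hs.subset hx, (hs.map g).trans h2⟩

theorem contains_map_add_left {w p : List ℕ} (b : ℕ) :
    Contains (w.map (· + b)) p ↔ Contains w p := by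
  simp only [contains_iff]
  constructor
  · rintro ⟨g, h1, h2⟩
    -- This keeps the truncated subtraction below strictly monotone.
    have hb : ∀ x ∈ p, b ≤ g x := by
      intro x hx
      obtain ⟨y, -, hy⟩ := List.mem_map.1 (h2.subset (List.mem_map_of_mem hx))
      omega
    refine ⟨fun x => g x - b, fun x hx y hy hxy => ?_, ?_⟩
    · have := h1 hx hy hxy
      have := hb x hx
      simp only
      omega
    · have := h2.map (· - b)
      simpa [Function.comp_def] using this
  · rintro ⟨g, h1, h2⟩
    refine ⟨fun x => g x + b, fun x hx y hy hxy => Nat.add_lt_add_right (h1 hx hy hxy) b, ?_⟩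
    have := h2.map (· + b)
    simpa [Function.comp_def] using this

theorem contains_map_add_right {w p : List ℕ} (b : ℕ) :
    Contains w (p.map (· + b)) ↔ Contains w p := by
  simp only [contains_iff]
  constructor
  · rintro ⟨g, h1, h2⟩
    refine ⟨fun x => g (x + b), fun x hx y hy hxy => h1 ?_ ?_ (Nat.add_lt_add_right hxy b), ?_⟩
    · exact List.mem_map_of_mem (f := (· + b)) hx
    · exact List.mem_map_of_mem (f := (· + b)) hy
    · simpa [Function.comp_def] using h2
  · rintro ⟨g, h1, h2⟩
    refine ⟨fun x => g (x - b), ?_, by simpa [Function.comp_def] using h2⟩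
    intro x hx y hy hxy
    obtain ⟨x', hx', rfl⟩ := List.mem_map.1 hx
    obtain ⟨y', hy', rfl⟩ := List.mem_map.1 hy
    simpa using h1 hx' hy' (by omega)

theorem IsPartition.one_le {w : List ℕ} (h : IsPartition w) {x : ℕ} (hx : x ∈ w) : 1 ≤ x :=
  (h.mem_iff.1 hx).1

theorem IsPartition.le_numBlocks {w : List ℕ} (h : IsPartition w) {x : ℕ} (hx : x ∈ w) :
    x ≤ numBlocks w := (h.mem_iff.1 hx).2

theorem isPartition_one : IsPartition [1] :=
  (isPartition_snoc (w := [])).2 ⟨isPartition_nil, by simp⟩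

theorem numBlocks_pos {w : List ℕ} (h0 : w ≠ []) : 0 < numBlocks w :=
  Finset.card_pos.2 ((List.toFinset_nonempty_iff w).2 h0)

/-! The word `1[s₁]1⋯[s_k]1`. -/

theorem chain_nil : chain [] = [1] := rfl

theorem chain_snoc (U : List (List ℕ)) (s : List ℕ) :
    chain (U ++ [s]) = chain U ++ s.map (· + numBlocks (chain U)) ++ [1] := by
  simp [chain, bracket, List.foldl_append]

theorem bracketAll_snoc (U : List (List ℕ)) (s : List ℕ) :
    bracketAll (U ++ [s]) = bracketAll U ++ s.map (· + numBlocks (bracketAll U)) := by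
  simp [bracketAll, bracket, List.foldl_append]

theorem chain_cons_one (U : List (List ℕ)) : ∃ v, chain U = 1 :: v := by
  induction U using List.reverseRecOn with
  | nil => exact ⟨[], rfl⟩
  | append_singleton U s ih =>
    obtain ⟨v, hv⟩ := ih
    rw [chain_snoc, hv]
    exact ⟨_, rfl⟩

theorem chain_snoc_one (U : List (List ℕ)) : ∃ v, chain U = v ++ [1] := by
  cases U using List.reverseRecOn with
  | nil => exact ⟨[], rfl⟩
  | append_singleton U s => exact ⟨_, chain_snoc U s⟩

theorem one_mem_chain (U : List (List ℕ)) : 1 ∈ chain U := by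
  obtain ⟨v, hv⟩ := chain_cons_one U
  simp [hv]

theorem chain_ne_nil (U : List (List ℕ)) : chain U ≠ [] :=
  List.ne_nil_of_mem (one_mem_chain U)

theorem numBlocks_chain_pos (U : List (List ℕ)) : 0 < numBlocks (chain U) :=
  numBlocks_pos (chain_ne_nil U)

theorem isPartition_chain {U : List (List ℕ)} (hU : ∀ s ∈ U, IsPartition s) :
    IsPartition (chain U) := by
  induction U using List.reverseRecOn with
  | nil => exact isPartition_one
  | append_singleton U s ih =>
    rw [chain_snoc, isPartition_snoc]
    exact ⟨(ih fun t ht => hU t (by simp [ht])).bracket (hU s (by simp)), le_rfl, by simp⟩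

theorem isPartition_bracketAll {U : List (List ℕ)} (hU : ∀ s ∈ U, IsPartition s) :
    IsPartition (bracketAll U) := (bracketAll_spec U hU).1

theorem bracketAll_append {U V : List (List ℕ)} (hU : ∀ s ∈ U, IsPartition s)
    (hV : ∀ s ∈ V, IsPartition s) :
    bracketAll (U ++ V) = bracket (bracketAll U) (bracketAll V) := by
  rw [← (bracketAll_spec V hV).2 _ (isPartition_bracketAll hU)]
  simp [bracketAll, List.foldl_append]

theorem numBlocks_append_of_subset {u v : List ℕ} (h : v ⊆ u) :
    numBlocks (u ++ v) = numBlocks u := by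
  rw [numBlocks, numBlocks, List.toFinset_append, Finset.union_eq_left.2]
  intro x hx
  simpa using h (by simpa using hx)

theorem numBlocks_chain_append {U V : List (List ℕ)} (hU : ∀ s ∈ U, IsPartition s)
    (hV : ∀ s ∈ V, IsPartition s) :
    numBlocks (chain (U ++ V)) = numBlocks (chain U) + numBlocks (bracketAll V) := by
  induction V using List.reverseRecOn with
  | nil => simp [bracketAll, numBlocks]
  | append_singleton V s ih =>
    have hV' : ∀ s ∈ V, IsPartition s := fun t ht => hV t (by simp [ht])
    have hUV : ∀ s ∈ U ++ V, IsPartition s := fun t ht => (List.mem_append.1 ht).elim (hU t) (hV' t)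
    have hs := hV s (by simp)
    rw [← List.append_assoc, chain_snoc, numBlocks_append_of_subset, bracketAll_snoc]
    · have h1 := numBlocks_bracket (isPartition_chain hUV) hs
      have h2 := numBlocks_bracket (isPartition_bracketAll hV') hs
      rw [bracket] at h1 h2
      rw [h1, h2, ih hV', add_assoc]
    · simp [one_mem_chain]

/-- An occurrence that starts and ends with the same letter lies within one of two words, when the
letters of these are disjoint. -/
theorem sublist_or_of_endpoints {u X Y : List ℕ} {c : ℕ} (h1 : ∃ v, u = c :: v)
    (h2 : ∃ v, u = v ++ [c]) (h : u.Sublist (X ++ Y)) :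
    (c ∉ Y → u.Sublist X) ∧ (c ∉ X → u.Sublist Y) := by
  obtain ⟨a, b, rfl, ha, hb⟩ := List.sublist_append_iff.1 h
  constructor
  · intro hc
    obtain ⟨v, hv⟩ := h2
    rcases b.eq_nil_or_concat' with rfl | ⟨b, d, rfl⟩
    · simpa using ha
    · rw [← List.append_assoc] at hv
      obtain ⟨-, rfl⟩ : a ++ b = v ∧ d = c := by simpa using List.append_inj' hv rfl
      exact absurd (hb.subset (by simp)) hc
  · intro hc
    obtain ⟨v, hv⟩ := h1
    cases a with
    | nil => simpa using hb
    | cons d a =>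
      obtain ⟨rfl, -⟩ := List.cons.inj hv
      exact absurd (ha.subset (by simp)) hc

theorem lt_of_mem_map_add {s : List ℕ} (hs : IsPartition s) {b x : ℕ}
    (hx : x ∈ s.map (· + b)) : b < x := by
  obtain ⟨y, hy, rfl⟩ := List.mem_map.1 hx
  have := hs.one_le hy
  omega

theorem map_chain_endpoints (L : List (List ℕ)) (g : ℕ → ℕ) :
    (∃ v, (chain L).map g = g 1 :: v) ∧ ∃ v, (chain L).map g = v ++ [g 1] := by
  obtain ⟨v, hv⟩ := chain_cons_one L
  obtain ⟨v', hv'⟩ := chain_snoc_one L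
  exact ⟨⟨v.map g, by simp [hv]⟩, ⟨v'.map g, by simp [hv']⟩⟩

/-- The chain pattern begins and ends with `1`, so its image begins and ends with `g 1`, a letter
that occurs in only one of the two pieces. -/
theorem contains_bracket_chain {u v : List ℕ} (L : List (List ℕ)) (hu : IsPartition u)
    (hv : IsPartition v) :
    Contains (bracket u v) (chain L) ↔ Contains u (chain L) ∨ Contains v (chain L) := by
  constructor
  · intro h
    obtain ⟨g, h1, h2⟩ := contains_iff.1 h
    obtain ⟨e1, e2⟩ := map_chain_endpoints L g
    obtain ⟨h3, h4⟩ := sublist_or_of_endpoints e1 e2 h2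
    by_cases hc : g 1 ∈ u
    · refine Or.inl (contains_iff.2 ⟨g, h1, h3 fun hc' => ?_⟩)
      have := lt_of_mem_map_add hv hc'
      have := hu.le_numBlocks hc
      omega
    · exact Or.inr ((contains_map_add_left _).1 (contains_iff.2 ⟨g, h1, h4 hc⟩))
  · rintro (h | h)
    · exact h.of_sublist (List.sublist_append_left _ _)
    · exact ((contains_map_add_left _).2 h).of_sublist (List.sublist_append_right _ _)

theorem not_contains_nil_chain (L : List (List ℕ)) : ¬ Contains [] (chain L) := by
  intro h
  obtain ⟨g, -, h⟩ := contains_iff.1 h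
  simp [chain_ne_nil] at h

theorem contains_bracketAll_chain {U : List (List ℕ)} (L : List (List ℕ))
    (hU : ∀ s ∈ U, IsPartition s) :
    Contains (bracketAll U) (chain L) ↔ ∃ s ∈ U, Contains s (chain L) := by
  induction U with
  | nil => simpa [bracketAll] using not_contains_nil_chain L
  | cons s U ih =>
    have hU' : ∀ s ∈ U, IsPartition s := fun t ht => hU t (by simp [ht])
    rw [bracketAll_cons s U (hU s (by simp)) hU',
      contains_bracket_chain L (hU s (by simp)) (isPartition_bracketAll hU'), ih hU']
    simp

theorem sublist_chain_of_mem {U : List (List ℕ)} {s : List ℕ} (hs : s ∈ U) :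
    ∃ b, (s.map (· + b)).Sublist (chain U) := by
  induction U using List.reverseRecOn with
  | nil => simp at hs
  | append_singleton U t ih =>
    rw [chain_snoc]
    rcases List.mem_append.1 hs with hs | hs
    · obtain ⟨b, hb⟩ := ih hs
      exact ⟨b, hb.trans (by simp)⟩
    · obtain rfl : s = t := by simpa using hs
      exact ⟨_, (List.sublist_append_right _ _).trans (List.sublist_append_left _ _)⟩

theorem Contains.of_mem_chain {w s : List ℕ} {L : List (List ℕ)} (h : Contains w (chain L))
    (hs : s ∈ L) : Contains w s := by
  obtain ⟨b, hb⟩ := sublist_chain_of_mem hs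
  exact (contains_map_add_right b).1 (h.pattern_sublist hb)

/-- When `g 1` is not the outer letter, it belongs to a single shifted part, and the occurrence is
enclosed between two copies of it. -/
theorem exists_contains_of_letter_ne_one {U L : List (List ℕ)} (hU : ∀ s ∈ U, IsPartition s)
    {g : ℕ → ℕ} (hg : StrictMonoOn g {x | x ∈ chain L}) (h1 : g 1 ≠ 1)
    (h : ((chain L).map g).Sublist (chain U)) : ∃ s ∈ U, Contains s (chain L) := by
  obtain ⟨e1, e2⟩ := map_chain_endpoints L g
  induction U using List.reverseRecOn with
  | nil =>
    have : g 1 ∈ chain [] := h.subset (List.mem_map_of_mem (one_mem_chain L))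
    simp [chain_nil, h1] at this
  | append_singleton U t ih =>
    have hU' : ∀ s ∈ U, IsPartition s := fun t ht => hU t (by simp [ht])
    rw [chain_snoc] at h
    have h2 := (sublist_or_of_endpoints e1 e2 h).1 (by simpa using h1)
    obtain ⟨h3, h4⟩ := sublist_or_of_endpoints e1 e2 h2
    by_cases hc : g 1 ∈ chain U
    · obtain ⟨s, hs, hs'⟩ := ih hU' (h3 fun hc' => by
        have := lt_of_mem_map_add (hU t (by simp)) hc'
        have := (isPartition_chain hU').le_numBlocks hc
        omega)
      exact ⟨s, by simp [hs], hs'⟩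
    · exact ⟨t, by simp, (contains_map_add_left _).1 (contains_iff.2 ⟨g, hg, h4 hc⟩)⟩

/-- The last letter of `u` does not occur in `T`, so all of `u` is matched in `X`; only `S` may
straddle the boundary. -/
theorem sublist_append_of_endpoint {u S X T : List ℕ} {c : ℕ} (hu : ∃ v, u = v ++ [c])
    (hc : c ∉ T) (h : (u ++ S).Sublist (X ++ T)) :
    ∃ S₁ S₂, S = S₁ ++ S₂ ∧ (u ++ S₁).Sublist X ∧ S₂.Sublist T := by
  obtain ⟨a, b, e, ha, hb⟩ := List.sublist_append_iff.1 h
  rcases List.append_eq_append_iff.1 e with ⟨C, rfl, rfl⟩ | ⟨C, rfl, rfl⟩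
  · exact ⟨C, b, rfl, ha, hb⟩
  · obtain ⟨v, hv⟩ := hu
    rcases C.eq_nil_or_concat' with rfl | ⟨C, d, rfl⟩
    · exact ⟨[], S, rfl, by simpa using ha, by simpa using hb⟩
    · rw [← List.append_assoc] at hv
      obtain ⟨-, rfl⟩ : a ++ C = v ∧ d = c := by simpa using List.append_inj' hv rfl
      exact absurd (hb.subset (by simp)) hc

/-- In an occurrence of a word that starts with a word ending in `1` and has no later `1`, the
second part lies in a terminal interval of the parts of a chain. -/
theorem exists_split_of_sublist_chain {U : List (List ℕ)} (hU : ∀ s ∈ U, IsPartition s)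
    {u S : List ℕ} (hu : ∃ v, u = v ++ [1]) (hS : 1 ∉ S) (h : (u ++ S).Sublist (chain U)) :
    ∃ I J, U = I ++ J ∧ u.Sublist (chain I) ∧
      S.Sublist ((bracketAll J).map (· + numBlocks (chain I))) := by
  induction U using List.reverseRecOn generalizing S with
  | nil =>
    obtain ⟨v, rfl⟩ := hu
    have := h.length_le
    simp [chain_nil] at this
    obtain ⟨rfl, rfl⟩ : v = [] ∧ S = [] := by
      constructor <;> apply List.eq_nil_of_length_eq_zero <;> omega
    exact ⟨[], [], rfl, by simp [chain_nil], by simp⟩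
  | append_singleton U t ih =>
    have hU' : ∀ s ∈ U, IsPartition s := fun t ht => hU t (by simp [ht])
    rcases S.eq_nil_or_concat' with rfl | ⟨S, d, rfl⟩
    · exact ⟨U ++ [t], [], by simp, by simpa using h, by simp⟩
    have h2 : (u ++ (S ++ [d])).Sublist (chain U ++ t.map (· + numBlocks (chain U))) := by
      rw [chain_snoc, List.sublist_append_iff] at h
      obtain ⟨a, b, e, ha, hb⟩ := h
      rcases b.eq_nil_or_concat' with rfl | ⟨b, x, rfl⟩
      · rw [e]; simpa using ha
      · rw [← List.append_assoc, ← List.append_assoc] at e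
        obtain ⟨-, rfl⟩ : u ++ S = a ++ b ∧ d = x := by simpa using List.append_inj' e rfl
        have : d ∈ [1] := hb.subset (by simp)
        simp at this
        simp [this] at hS
    have h1 : 1 ∉ t.map (· + numBlocks (chain U)) := fun h => by
      have := lt_of_mem_map_add (hU t (by simp)) h
      have := numBlocks_chain_pos U
      omega
    obtain ⟨S₁, S₂, e, h3, h4⟩ := sublist_append_of_endpoint hu h1 h2
    rw [e] at hS ⊢
    obtain ⟨I, J, rfl, h5, h6⟩ := ih hU' (fun h => hS (by simp [h])) h3
    refine ⟨I, J ++ [t], by simp, h5, ?_⟩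
    have hI : ∀ s ∈ I, IsPartition s := fun t ht => hU' t (by simp [ht])
    have hJ : ∀ s ∈ J, IsPartition s := fun t ht => hU' t (by simp [ht])
    rw [bracketAll_snoc, List.map_append]
    refine h6.append ?_
    rw [numBlocks_chain_append hI hJ] at h4
    simpa [Function.comp_def, add_assoc, add_comm, add_left_comm] using h4

/-- The second part supplies the closing `1` of an occurrence. It needs `J ≠ []`, since otherwise no
`1` is left after `chain I`; this is why `containing` admits only nonempty words. -/
theorem chain_append_sublist {I J : List (List ℕ)} (hI : ∀ s ∈ I, IsPartition s)
    (hJ : ∀ s ∈ J, IsPartition s) :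
    (chain I ++ (bracketAll J).map (· + numBlocks (chain I))).Sublist (chain (I ++ J)) ∧
      (J ≠ [] → (chain I ++ (bracketAll J).map (· + numBlocks (chain I)) ++ [1]).Sublist
        (chain (I ++ J))) := by
  induction J using List.reverseRecOn with
  | nil => simp [bracketAll]
  | append_singleton J t ih =>
    have hJ' : ∀ s ∈ J, IsPartition s := fun t ht => hJ t (by simp [ht])
    have key : (chain I ++ (bracketAll (J ++ [t])).map (· + numBlocks (chain I)) ++ [1]).Sublist
        (chain (I ++ (J ++ [t]))) := by
      rw [← List.append_assoc, chain_snoc, bracketAll_snoc, List.map_append, ← List.append_assoc]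
      refine List.Sublist.append (List.Sublist.append (ih hJ').1 ?_) (.refl _)
      rw [numBlocks_chain_append hI hJ']
      simp [Function.comp_def, add_assoc, add_comm]
    exact ⟨(List.sublist_append_left _ _).trans key, fun _ => key⟩

/-! ### Non-crossing partitions and the chain form of the connected ones. -/

theorem nonCrossing_iff_sublist {w : List ℕ} :
    NonCrossing w ↔ ∀ a b, [a, b, a, b].Sublist w → a = b := by
  constructor
  · intro h a b hs
    by_contra hab
    obtain ⟨f, hf⟩ := List.sublist_iff_exists_fin_orderEmbedding_get_eq.1 hs
    have h0 := hf 0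
    have h1 := hf 1
    have h2 := hf 2
    have h3 := hf 3
    simp at h0 h1 h2 h3
    have lt : ∀ i j : Fin 4, i < j → f i < f j := fun i j hij => f.strictMono hij
    refine h ⟨f 0, f 1, f 2, f 3, lt 0 1 (by decide), lt 1 2 (by decide), lt 2 3 (by decide), ?_, ?_, ?_⟩ <;> simp only [List.get_eq_getElem] <;> omega
  · rintro h ⟨i, j, k, l, hij, hjk, hkl, h1, h2, h3⟩
    refine h3 (h _ _ (List.sublist_iff_exists_fin_orderEmbedding_get_eq.2
      ⟨OrderEmbedding.ofStrictMono (![i, j, k, l] : Fin 4 → Fin w.length) ?_, ?_⟩))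
    · refine Fin.strictMono_iff_lt_succ.2 fun a => ?_
      fin_cases a
      · exact hij
      · exact hjk
      · exact hkl
    · rintro ⟨a, ha⟩
      simp only [List.length_cons, List.length_nil] at ha
      interval_cases a
      · rfl
      · rfl
      · exact h1
      · exact h2

theorem NonCrossing.of_sublist {v w : List ℕ} (h : NonCrossing w) (hs : v.Sublist w) :
    NonCrossing v :=
  nonCrossing_iff_sublist.2 fun a b hab => nonCrossing_iff_sublist.1 h a b (hab.trans hs)

theorem nonCrossing_map_add {w : List ℕ} (b : ℕ) :
    NonCrossing (w.map (· + b)) ↔ NonCrossing w := by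
  simp [NonCrossing]
  constructor
  · intro h i j hij k hjk l hkl
    simpa using h (Fin.cast (by simp) i) (Fin.cast (by simp) j) hij (Fin.cast (by simp) k) hjk
      (Fin.cast (by simp) l) hkl
  · intro h i j hij k hjk l hkl
    exact h (Fin.cast (by simp) i) (Fin.cast (by simp) j) hij (Fin.cast (by simp) k) hjk
      (Fin.cast (by simp) l) hkl

theorem NonCrossing.append {u v : List ℕ} (hu : NonCrossing u) (hv : NonCrossing v)
    (h : u.Disjoint v) : NonCrossing (u ++ v) := by
  refine nonCrossing_iff_sublist.2 fun a b hs => ?_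
  obtain ⟨x, y, e, hx, hy⟩ := List.sublist_append_iff.1 hs
  have hd : ∀ c ∈ x, c ∉ y := fun c h1 h2 => h (hx.subset h1) (hy.subset h2)
  -- If one to three letters of `abab` fall in `u`, some letter occurs on both sides, against
  -- disjointness.
  rcases x with _ | ⟨x1, _ | ⟨x2, _ | ⟨x3, _ | ⟨x4, x⟩⟩⟩⟩
  · obtain rfl : _ = y := by simpa using e
    exact nonCrossing_iff_sublist.1 hv a b hy
  all_goals simp at e
  · obtain ⟨rfl, rfl⟩ := e
    simp at hd
  · obtain ⟨rfl, rfl, rfl⟩ := e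
    simp at hd
  · obtain ⟨rfl, rfl, rfl, rfl⟩ := e
    simp at hd
  · obtain ⟨rfl, rfl, rfl, rfl, rfl, rfl⟩ := e
    exact nonCrossing_iff_sublist.1 hu _ _ hx

theorem nonCrossing_bracket {u v : List ℕ} (hu : IsPartition u) (hv : IsPartition v)
    (h1 : NonCrossing u) (h2 : NonCrossing v) : NonCrossing (bracket u v) := by
  refine h1.append ((nonCrossing_map_add _).2 h2) fun x hx hx' => ?_
  have := hu.le_numBlocks hx
  have := lt_of_mem_map_add hv hx'
  omega

theorem nonCrossing_nil : NonCrossing [] := fun ⟨i, _⟩ => i.elim0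

theorem nonCrossing_bracketAll {U : List (List ℕ)} (hU : ∀ s ∈ U, IsPartition s)
    (h : ∀ s ∈ U, NonCrossing s) : NonCrossing (bracketAll U) := by
  induction U using List.reverseRecOn with
  | nil => exact nonCrossing_nil
  | append_singleton U s ih =>
    have hU' : ∀ s ∈ U, IsPartition s := fun t ht => hU t (by simp [ht])
    rw [bracketAll_snoc]
    exact nonCrossing_bracket (isPartition_bracketAll hU') (hU s (by simp))
      (ih hU' fun t ht => h t (by simp [ht])) (h s (by simp))

/-- A crossing created by the final `1` has the form `a1a1`. The part `a1a` cannot lie in the new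
shifted part, which has no `1`; if it lies in the earlier chain, the initial `1` already gives the
crossing `1a1a` there. -/
theorem nonCrossing_chain {U : List (List ℕ)} (hU : ∀ s ∈ U, IsPartition s)
    (h : ∀ s ∈ U, NonCrossing s) : NonCrossing (chain U) := by
  induction U using List.reverseRecOn with
  | nil => exact nonCrossing_iff_sublist.2 fun a b hs => by simpa [chain_nil] using hs.length_le
  | append_singleton U s ih =>
    have hU' : ∀ s ∈ U, IsPartition s := fun t ht => hU t (by simp [ht])
    have hs := hU s (by simp)
    have ih' := ih hU' fun t ht => h t (by simp [ht])
    have hX := nonCrossing_bracket (isPartition_chain hU') hs ih' (h s (by simp))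
    rw [bracket] at hX
    rw [chain_snoc]
    refine nonCrossing_iff_sublist.2 fun a b hsub => ?_
    by_contra hab
    by_cases hb : b = 1
    · subst hb
      have h1 : [a, 1, a].Sublist (chain U ++ s.map (· + numBlocks (chain U))) :=
        List.append_sublist_append_right [1] |>.1 (by simpa using hsub)
      have h1T : 1 ∉ s.map (· + numBlocks (chain U)) := fun h => by
        have := lt_of_mem_map_add hs h
        have := numBlocks_chain_pos U
        omega
      obtain ⟨h2, h3⟩ := sublist_or_of_endpoints (c := a) ⟨_, rfl⟩ ⟨[a, 1], rfl⟩ h1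
      by_cases ha : a ∈ chain U
      · have h4 := h2 fun h => by
          have := (isPartition_chain hU').le_numBlocks ha
          have := lt_of_mem_map_add hs h
          omega
        obtain ⟨v, hv⟩ := chain_cons_one U
        rw [hv] at h4 ih'
        rcases List.sublist_cons_iff.1 h4 with h5 | ⟨r, h5, -⟩
        · exact hab (nonCrossing_iff_sublist.1 ih' 1 a (h5.cons_cons 1)).symm
        · simp at h5
          exact hab h5.1
      · exact h1T ((h3 ha).subset (by simp))
    · obtain ⟨x, y, e, hx, hy⟩ := List.sublist_append_iff.1 hsub
      rcases y.eq_nil_or_concat' with rfl | ⟨y, d, rfl⟩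
      · exact hab (nonCrossing_iff_sublist.1 hX a b (by rw [e]; simpa using hx))
      · have hd : d = 1 := by simpa using hy.subset (show d ∈ y ++ [d] by simp)
        rw [← List.append_assoc] at e
        have e2 := List.append_inj' (show [a, b, a] ++ [b] = _ from e) rfl
        simp at e2
        omega

/-- A chain ends in `1`, whereas `s[t]` with both parts nonempty ends in a letter greater than `1`.
-/
theorem connected_chain (U : List (List ℕ)) : Connected (chain U) := by
  rintro ⟨s, t, hs, ht, hs0, ht0, e⟩
  obtain ⟨v, hv⟩ := chain_snoc_one U
  rcases t.eq_nil_or_concat' with rfl | ⟨t, d, rfl⟩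
  · exact ht0 rfl
  · rw [hv, bracket, List.map_append, ← List.append_assoc] at e
    have h1 := (List.append_inj' e rfl).2
    have h2 := numBlocks_pos hs0
    have h3 := ht.one_le (show d ∈ t ++ [d] by simp)
    simp at h1
    omega

/-- The word is read letter by letter, with `v` the portion after the last `1`. A new `1` closes `v`
into a further part. Any other letter already used in the chain would give `1a1a`, so the letter
lies above the chain and extends `v`. -/
theorem exists_eq_bracket_chain {w : List ℕ} (hw : IsPartition w) (hn : NonCrossing w)
    (h0 : w ≠ []) : ∃ U v, (∀ s ∈ U, IsPartition s) ∧ IsPartition v ∧ w = bracket (chain U) v := by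
  induction w using List.reverseRecOn with
  | nil => exact absurd rfl h0
  | append_singleton w a ih =>
    obtain ⟨hw', h1, h2⟩ := isPartition_snoc.1 hw
    by_cases h3 : w = []
    · subst h3
      obtain rfl : a = 1 := by simp at h2; omega
      exact ⟨[], [], by simp, isPartition_nil, by simp [chain_nil, bracket]⟩
    obtain ⟨U, v, hU, hv, e⟩ := ih hw' (hn.of_sublist (List.sublist_append_left _ _)) h3
    by_cases ha1 : a = 1
    · subst ha1
      refine ⟨U ++ [v], [], ?_, isPartition_nil, ?_⟩
      · intro s hs
        rcases List.mem_append.1 hs with hs | hs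
        · exact hU s hs
        · rwa [List.mem_singleton.1 hs]
      · rw [chain_snoc, e]
        simp [bracket]
    have hb : numBlocks (chain U) < a := by
      by_contra! hb
      have hmem : a ∈ chain U := (isPartition_chain hU).mem_iff.2 ⟨h1, hb⟩
      obtain ⟨x, hx⟩ := chain_cons_one U
      obtain ⟨y, hy⟩ := chain_snoc_one U
      have hay : a ∈ y := by
        rw [hy] at hmem
        simpa [ha1] using hmem
      have hs : [1, a, 1].Sublist (chain U) := by
        rw [hy]
        refine List.Sublist.append (l₁ := [1, a]) ?_ (.refl [1])
        cases y with
        | nil => simp at hay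
        | cons d y =>
          rw [hy] at hx
          obtain ⟨rfl, -⟩ := List.cons.inj hx
          exact (List.singleton_sublist.2 (by simpa [ha1] using hay)).cons_cons _
      have hs' : [1, a, 1, a].Sublist (w ++ [a]) := by
        refine List.Sublist.append (l₁ := [1, a, 1]) ?_ (.refl [a])
        rw [e]
        exact hs.trans (List.sublist_append_left _ _)
      exact ha1 (nonCrossing_iff_sublist.1 hn 1 a hs').symm
    refine ⟨U, v ++ [a - numBlocks (chain U)], hU, isPartition_snoc.2 ⟨hv, by omega, ?_⟩, ?_⟩
    · rw [hw'.foldr_max, e, numBlocks_bracket (isPartition_chain hU) hv] at h2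
      rw [hv.foldr_max]
      omega
    · rw [e]
      simp [bracket]
      omega

theorem nonCrossing_of_mem_chain {U : List (List ℕ)} (h : NonCrossing (chain U)) {s : List ℕ}
    (hs : s ∈ U) : NonCrossing s := by
  obtain ⟨b, hb⟩ := sublist_chain_of_mem hs
  exact (nonCrossing_map_add b).1 (h.of_sublist hb)

theorem exists_eq_chain {w : List ℕ} (hw : IsPartition w) (hn : NonCrossing w)
    (h0 : w ≠ []) (hc : Connected w) :
    ∃ U, (∀ s ∈ U, IsPartition s ∧ NonCrossing s) ∧ w = chain U := by
  obtain ⟨U, v, hU, hv, e⟩ := exists_eq_bracket_chain hw hn h0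
  have hv0 : v = [] := by
    by_contra hv0
    exact hc ⟨chain U, v, isPartition_chain hU, hv, chain_ne_nil U, hv0, e⟩
  have e' : w = chain U := by rw [e, hv0]; simp [bracket]
  exact ⟨U, fun s hs => ⟨hU s hs, nonCrossing_of_mem_chain (e' ▸ hn) hs⟩, e'⟩

/-- A nonempty `C` would end in `1` as a suffix of a chain, yet `S`, which begins with `C`, has no
`1`. -/
theorem append_right_eq_nil_of_chain {U V : List (List ℕ)} {S C T : List ℕ}
    (hS : 1 ∉ S) (e : chain V = chain U ++ C) (e' : S = C ++ T) : C = [] := by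
  rcases C.eq_nil_or_concat' with rfl | ⟨C, d, rfl⟩
  · rfl
  · obtain ⟨v, hv⟩ := chain_snoc_one V
    rw [hv, ← List.append_assoc] at e
    obtain ⟨-, h⟩ := List.append_inj' e rfl
    obtain rfl : 1 = d := by simpa using h
    simp [e'] at hS

theorem chain_injective {U V : List (List ℕ)} (hU : ∀ s ∈ U, IsPartition s)
    (hV : ∀ s ∈ V, IsPartition s) (e : chain U = chain V) : U = V := by
  have hlen : ∀ (W : List (List ℕ)) t, 1 < (chain (W ++ [t])).length := by
    intro W t
    have := List.length_pos_of_ne_nil (chain_ne_nil W)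
    rw [chain_snoc]
    simp
    omega
  have hone : ∀ (W : List (List ℕ)) t, IsPartition t → 1 ∉ t.map (· + numBlocks (chain W)) := by
    intro W t ht h
    have := lt_of_mem_map_add ht h
    have := numBlocks_chain_pos W
    omega
  induction U using List.reverseRecOn generalizing V with
  | nil =>
    rcases V.eq_nil_or_concat' with rfl | ⟨V, t, rfl⟩
    · rfl
    · have := hlen V t
      simp [← e, chain_nil] at this
  | append_singleton U s ih =>
    rcases V.eq_nil_or_concat' with rfl | ⟨V, t, rfl⟩
    · have := hlen U s
      simp [e, chain_nil] at this
    have hs := hone U s (hU s (by simp))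
    have ht := hone V t (hV t (by simp))
    rw [chain_snoc, chain_snoc] at e
    have e2 := List.append_cancel_right e
    have e3 : chain U = chain V := by
      rcases List.append_eq_append_iff.1 e2 with ⟨C, e4, e5⟩ | ⟨C, e4, e5⟩
      · simpa [append_right_eq_nil_of_chain hs e4 e5] using e4.symm
      · simpa [append_right_eq_nil_of_chain ht e4 e5] using e4
    rw [e3] at e2
    have e6 : s = t := List.map_injective_iff.2 (fun x y h => by simpa using h)
      (List.append_cancel_left e2)
    rw [ih (fun t ht => hU t (by simp [ht])) (fun t ht => hV t (by simp [ht])) e3, e6]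

/-! ### Occurrences of a chain as factorizations of words. -/

/-- The non-crossing partitions. -/
abbrev NCPartition := {w : List ℕ // IsPartition w ∧ NonCrossing w}

/-- The underlying sequences of a list of non-crossing partitions. -/
abbrev vals (U : List NCPartition) : List (List ℕ) := U.map Subtype.val

theorem isPartition_of_mem_vals {U : List NCPartition} : ∀ s ∈ vals U, IsPartition s := by
  intro s hs
  obtain ⟨w, -, rfl⟩ := List.mem_map.1 hs
  exact w.2.1

theorem nonCrossing_of_mem_vals {U : List NCPartition} : ∀ s ∈ vals U, NonCrossing s := by
  intro s hs
  obtain ⟨w, -, rfl⟩ := List.mem_map.1 hs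
  exact w.2.2

theorem exists_vals_eq {U : List (List ℕ)} (h : ∀ s ∈ U, IsPartition s ∧ NonCrossing s) :
    ∃ V : List NCPartition, vals V = U := by
  induction U with
  | nil => exact ⟨[], rfl⟩
  | cons s U ih =>
    obtain ⟨V, rfl⟩ := ih fun t ht => h t (by simp [ht])
    exact ⟨⟨s, h s (by simp)⟩ :: V, rfl⟩

theorem vals_injective : Function.Injective vals :=
  List.map_injective_iff.2 Subtype.val_injective

theorem vals_append (I J : List NCPartition) : vals (I ++ J) = vals I ++ vals J :=
  List.map_append

/-- The nonempty words `π₁⋯π_m` for which `π₁[π₂]⋯[π_m]` contains `s`. -/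
def containing (s : List ℕ) : Language NCPartition :=
  {I | I ≠ [] ∧ Contains (bracketAll (vals I)) s}

theorem mem_containing {s : List ℕ} {I : List NCPartition} :
    I ∈ containing s ↔ I ≠ [] ∧ Contains (bracketAll (vals I)) s := Iff.rfl

theorem bracketAll_vals_append (I J : List NCPartition) :
    bracketAll (vals (I ++ J)) = bracket (bracketAll (vals I)) (bracketAll (vals J)) := by
  rw [vals_append]
  exact bracketAll_append isPartition_of_mem_vals isPartition_of_mem_vals

theorem infixClosed_containing (s : List ℕ) : InfixClosed (containing s) := by
  rintro I ⟨h0, h⟩ X Y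
  refine ⟨by simp [h0], ?_⟩
  rw [bracketAll_vals_append, bracketAll_vals_append]
  exact ((contains_map_add_left _).2 h).of_sublist
    ((List.sublist_append_right _ _).trans (List.sublist_append_left _ _))

/-- The words `π₁⋯π_m` for which `1[π₁]1⋯1[π_m]1` has an occurrence of `1[s₁]1⋯1[s_k]1` that
starts in the first letter. -/
def splitting (L : List (List ℕ)) : Language NCPartition := ⊤ * (L.map containing).prod

theorem splitting_snoc (L : List (List ℕ)) (s : List ℕ) :
    splitting (L ++ [s]) = splitting L * containing s := by
  simp [splitting, mul_assoc]

/-- The last part `s` of the pattern is peeled off. Its image has no `1`, so it lies in the parts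
following some initial factor `I` that accommodates the rest of the pattern. These parts form the
last factor, nonempty because it includes `t`. -/
theorem mem_splitting_of_sublist {L : List (List ℕ)} (hL : ∀ s ∈ L, IsPartition s) {g : ℕ → ℕ}
    (hg : StrictMonoOn g {x | x ∈ chain L}) (h1 : g 1 = 1) {U : List NCPartition}
    (h : ((chain L).map g).Sublist (chain (vals U))) : U ∈ splitting L := by
  induction L using List.reverseRecOn generalizing U with
  | nil => exact Language.mem_mul.2 ⟨U, trivial, [], rfl, by simp⟩
  | append_singleton L s ih =>
    have hL' : ∀ s ∈ L, IsPartition s := fun t ht => hL t (by simp [ht])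
    have hs := hL s (by simp)
    rcases U.eq_nil_or_concat' with rfl | ⟨U, t, rfl⟩
    · have h2 := h.length_le
      have := List.length_pos_of_ne_nil (chain_ne_nil L)
      rw [chain_snoc] at h2
      simp [chain_nil] at h2
      omega
    have hU : ∀ s ∈ vals U, IsPartition s := isPartition_of_mem_vals
    have hone : ∀ {x}, x ∈ s.map (· + numBlocks (chain L)) → 1 < g x := by
      intro x hx
      have := lt_of_mem_map_add hs hx
      have := numBlocks_chain_pos L
      rw [← h1]
      exact hg (one_mem_chain _) (by rw [chain_snoc]; simp at hx ⊢; exact Or.inr (Or.inl hx))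
        (by omega)
    have hvals : vals (U ++ [t]) = vals U ++ [t.1] := by simp [vals]
    rw [hvals, chain_snoc, chain_snoc, List.map_append, List.map_append] at h
    have h2 : ((chain L).map g ++ (s.map (· + numBlocks (chain L))).map g).Sublist
        (chain (vals U) ++ t.1.map (· + numBlocks (chain (vals U)))) :=
      (List.append_sublist_append_right [1]).1 (by simpa [h1] using h)
    have hend : ∃ v, (chain L).map g = v ++ [1] := h1 ▸ (map_chain_endpoints L g).2
    obtain ⟨S₁, S₂, e, h3, h4⟩ := sublist_append_of_endpoint hend (fun h => by
      have := lt_of_mem_map_add t.2.1 h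
      have := numBlocks_chain_pos (vals U)
      omega) h2
    obtain ⟨I, J, e2, h5, h6⟩ := exists_split_of_sublist_chain hU hend (fun h => by
      have h' : 1 ∈ (s.map (· + numBlocks (chain L))).map g := by rw [e]; simp [h]
      obtain ⟨x, hx, hx'⟩ := List.mem_map.1 h'
      have := hone hx
      omega) h3
    obtain ⟨I, J, rfl, rfl, rfl⟩ := List.map_eq_append_iff.1 e2
    rw [splitting_snoc, List.append_assoc]
    refine Language.append_mem_mul (ih hL' (hg.mono fun x hx => ?_) h5) ⟨by simp, ?_⟩
    · change x ∈ chain (L ++ [s])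
      rw [chain_snoc]
      exact List.mem_append_left _ (List.mem_append_left _ hx)
    · have h7 : ((s.map (· + numBlocks (chain L))).map g).Sublist
          ((bracketAll (vals (J ++ [t]))).map (· + numBlocks (chain (vals I)))) := by
        rw [e, vals_append, show vals [t] = [t.1] from rfl, bracketAll_snoc, List.map_append]
        refine h6.append ?_
        rw [vals_append,
          numBlocks_chain_append isPartition_of_mem_vals isPartition_of_mem_vals] at h4
        simpa [Function.comp_def, add_assoc, add_comm, add_left_comm] using h4
      rw [← contains_map_add_left (numBlocks (chain (vals I))),
        ← contains_map_add_right (numBlocks (chain L))]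
      refine contains_iff.2 ⟨g, hg.mono fun x hx => ?_, h7⟩
      change x ∈ chain (L ++ [s])
      rw [chain_snoc]
      exact List.mem_append_left _ (List.mem_append_right _ hx)

theorem exists_sublist_of_mem_splitting {L : List (List ℕ)} (hL : ∀ s ∈ L, IsPartition s)
    {U : List NCPartition} (h : U ∈ splitting L) :
    ∃ g : ℕ → ℕ, StrictMonoOn g {x | x ∈ chain L} ∧ g 1 = 1 ∧
      ((chain L).map g).Sublist (chain (vals U)) := by
  induction L using List.reverseRecOn generalizing U with
  | nil =>
    refine ⟨id, strictMonoOn_id, rfl, ?_⟩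
    simp [chain_nil, one_mem_chain]
  | append_singleton L s ih =>
    have hL' : ∀ s ∈ L, IsPartition s := fun t ht => hL t (by simp [ht])
    have hs := hL s (by simp)
    rw [splitting_snoc] at h
    obtain ⟨I, hI, J, ⟨hJ0, hJ⟩, rfl⟩ := Language.mem_mul.1 h
    obtain ⟨g, g1, g2, g3⟩ := ih hL' hI
    obtain ⟨f, f1, f2⟩ := contains_iff.1 hJ
    have hPI : IsPartition (chain (vals I)) := isPartition_chain isPartition_of_mem_vals
    have hPL := isPartition_chain hL'
    -- Letters of `chain L` follow `g`. Those of the shifted `s` follow `f`, raised above all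
    -- letters of `chain (vals I)`, which keeps `G` strictly monotone.
    let G : ℕ → ℕ := fun x =>
      if x ≤ numBlocks (chain L) then g x
      else f (x - numBlocks (chain L)) + numBlocks (chain (vals I))
    have G1 : ∀ x ∈ chain L, G x = g x := fun x hx => if_pos (hPL.le_numBlocks hx)
    have G2 : ∀ x ∈ s, G (x + numBlocks (chain L)) = f x + numBlocks (chain (vals I)) := by
      intro x hx
      have := hs.one_le hx
      simp only [G]
      rw [if_neg (by omega), Nat.add_sub_cancel]
    have b1 : ∀ x ∈ chain L, g x ≤ numBlocks (chain (vals I)) :=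
      fun x hx => hPI.le_numBlocks (g3.subset (List.mem_map_of_mem hx))
    have b2 : ∀ x ∈ s, 1 ≤ f x :=
      fun x hx => (isPartition_bracketAll isPartition_of_mem_vals).one_le
        (f2.subset (List.mem_map_of_mem hx))
    have hmem : ∀ x ∈ chain (L ++ [s]), x ∈ chain L ∨ ∃ y ∈ s, x = y + numBlocks (chain L) := by
      intro x hx
      rw [chain_snoc] at hx
      rcases List.mem_append.1 hx with hx | hx
      · rcases List.mem_append.1 hx with hx | hx
        · exact Or.inl hx
        · obtain ⟨y, hy, rfl⟩ := List.mem_map.1 hx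
          exact Or.inr ⟨y, hy, rfl⟩
      · obtain rfl : x = 1 := by simpa using hx
        exact Or.inl (one_mem_chain L)
    refine ⟨G, ?_, by rw [G1 1 (one_mem_chain L), g2], ?_⟩
    · intro x hx y hy hxy
      rcases hmem x hx with hx' | ⟨x, hx', rfl⟩ <;> rcases hmem y hy with hy' | ⟨y, hy', rfl⟩
      · rw [G1 x hx', G1 y hy']
        exact g1 hx' hy' hxy
      · rw [G1 x hx', G2 y hy']
        have := b1 x hx'
        have := b2 y hy'
        omega
      · have := hPL.le_numBlocks hy'
        omega
      · rw [G2 x hx', G2 y hy']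
        exact Nat.add_lt_add_right (f1 hx' hy' (by omega)) _
    · have e1 : (chain L).map G = (chain L).map g := List.map_congr_left G1
      have e2 : (s.map (· + numBlocks (chain L))).map G =
          (s.map f).map (· + numBlocks (chain (vals I))) := by
        rw [List.map_map, List.map_map]
        exact List.map_congr_left G2
      rw [chain_snoc, List.map_append, List.map_append, e1, e2, List.map_singleton,
        G1 1 (one_mem_chain L), g2, vals_append]
      exact ((g3.append (f2.map _)).append (.refl _)).trans
        ((chain_append_sublist isPartition_of_mem_vals isPartition_of_mem_vals).2
          fun h => hJ0 (List.map_eq_nil_iff.1 h))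

theorem contains_chain_chain_iff {L : List (List ℕ)} (hL : ∀ s ∈ L, IsPartition s)
    (U : List NCPartition) :
    Contains (chain (vals U)) (chain L) ↔
      U ∈ splitting L ∨ ∃ w ∈ U, Contains w.1 (chain L) := by
  constructor
  · intro h
    obtain ⟨g, h1, h2⟩ := contains_iff.1 h
    by_cases hg : g 1 = 1
    · exact Or.inl (mem_splitting_of_sublist hL h1 hg h2)
    · obtain ⟨s, hs, hs'⟩ :=
        exists_contains_of_letter_ne_one isPartition_of_mem_vals h1 hg h2
      obtain ⟨w, hw, rfl⟩ := List.mem_map.1 hs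
      exact Or.inr ⟨w, hw, hs'⟩
  · rintro (h | ⟨w, hw, h⟩)
    · obtain ⟨g, h1, -, h2⟩ := exists_sublist_of_mem_splitting hL h
      exact contains_iff.2 ⟨g, h1, h2⟩
    · obtain ⟨b, hb⟩ := sublist_chain_of_mem (List.mem_map_of_mem (f := Subtype.val) hw)
      exact ((contains_map_add_left b).2 h).of_sublist hb

/-! Decomposition of non-crossing partitions. -/

/-- `1[π₁]1⋯1[π_m]1` -/
def chainNC (U : List NCPartition) : NCPartition :=
  ⟨chain (vals U), isPartition_chain isPartition_of_mem_vals,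
    nonCrossing_chain isPartition_of_mem_vals nonCrossing_of_mem_vals⟩

/-- The non-crossing partition with the components `chainNC U`, for `U` in a given list. -/
def compose (l : List (List NCPartition)) : NCPartition :=
  ⟨bracketAll (vals (l.map chainNC)), isPartition_bracketAll isPartition_of_mem_vals,
    nonCrossing_bracketAll isPartition_of_mem_vals nonCrossing_of_mem_vals⟩

theorem isComponents_compose (l : List (List NCPartition)) :
    IsComponents (compose l).1 (vals (l.map chainNC)) := by
  refine ⟨fun s hs => ?_, rfl⟩
  obtain ⟨w, hw, rfl⟩ := List.mem_map.1 hs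
  obtain ⟨U, -, rfl⟩ := List.mem_map.1 hw
  exact ⟨(chainNC U).2.1, chain_ne_nil _, connected_chain _⟩

theorem chainNC_injective : Function.Injective chainNC := fun _ _ h =>
  vals_injective (chain_injective isPartition_of_mem_vals isPartition_of_mem_vals
    (congrArg Subtype.val h))

theorem sublist_of_mem_bracketAll {L : List (List ℕ)} {s : List ℕ} (hs : s ∈ L) :
    ∃ b, (s.map (· + b)).Sublist (bracketAll L) := by
  induction L using List.reverseRecOn with
  | nil => simp at hs
  | append_singleton L t ih =>
    rw [bracketAll_snoc]
    rcases List.mem_append.1 hs with hs | hs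
    · obtain ⟨b, hb⟩ := ih hs
      exact ⟨b, hb.trans (List.sublist_append_left _ _)⟩
    · obtain rfl : s = t := by simpa using hs
      exact ⟨_, List.sublist_append_right _ _⟩

theorem compose_bijective : Function.Bijective compose := by
  constructor
  · intro l m h
    have h1 := isComponents_compose l
    rw [h] at h1
    exact List.map_injective_iff.2 chainNC_injective
      (vals_injective (components_unique _ _ _ h1 (isComponents_compose m)))
  · rintro ⟨w, hw, hn⟩
    obtain ⟨L, hL, rfl⟩ := exists_components w hw
    have h1 : ∀ s ∈ L, ∃ U, (chainNC U).1 = s := by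
      intro s hs
      obtain ⟨b, hb⟩ := sublist_of_mem_bracketAll hs
      obtain ⟨a1, a2, a3⟩ := hL s hs
      obtain ⟨U, hU, rfl⟩ :=
        exists_eq_chain a1 ((nonCrossing_map_add b).1 (hn.of_sublist hb)) a2 a3
      obtain ⟨V, rfl⟩ := exists_vals_eq hU
      exact ⟨V, rfl⟩
    have h2 : ∃ l : List (List NCPartition), vals (l.map chainNC) = L := by
      clear hL hw hn
      induction L with
      | nil => exact ⟨[], rfl⟩
      | cons s L ih =>
        obtain ⟨l, rfl⟩ := ih fun t ht => h1 t (by simp [ht])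
        obtain ⟨U, rfl⟩ := h1 s (by simp)
        exact ⟨U :: l, rfl⟩
    obtain ⟨l, rfl⟩ := h2
    exact ⟨l, rfl⟩

/-- The decomposition of the components of a non-crossing partition. -/
noncomputable def decompose : NCPartition ≃ List (List NCPartition) :=
  (Equiv.ofBijective compose compose_bijective).symm

theorem compose_decompose (w : NCPartition) : compose (decompose w) = w :=
  (Equiv.ofBijective compose compose_bijective).apply_symm_apply w

theorem length_chain (U : List (List ℕ)) :
    (chain U).length = 1 + (U.map fun s => 1 + s.length).sum := by
  induction U using List.reverseRecOn with
  | nil => simp [chain_nil]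
  | append_singleton U s ih =>
    rw [chain_snoc]
    simp [ih]
    omega

theorem length_bracketAll (U : List (List ℕ)) :
    (bracketAll U).length = (U.map List.length).sum := by
  induction U using List.reverseRecOn with
  | nil => rfl
  | append_singleton U s ih =>
    rw [bracketAll_snoc]
    simp [ih]

theorem length_eq_sum_decompose (w : NCPartition) :
    w.1.length = ((decompose w).map fun U => 1 + (U.map fun v => 1 + v.1.length).sum).sum := by
  conv_lhs => rw [← compose_decompose w]
  simp only [compose, length_bracketAll, vals, List.map_map]
  congr 2
  ext U
  simp [chainNC, length_chain, Function.comp_def]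

theorem avoids_chain_iff {L : List (List ℕ)} (hL : ∀ s ∈ L, IsPartition s) (w : NCPartition) :
    Avoids w.1 (chain L) ↔
      ∀ U ∈ decompose w, U ∉ splitting L ∧ ∀ v ∈ U, Avoids v.1 (chain L) := by
  conv_lhs => rw [← compose_decompose w]
  rw [Avoids, compose, contains_bracketAll_chain L isPartition_of_mem_vals]
  have key : (∃ s ∈ vals ((decompose w).map chainNC), Contains s (chain L)) ↔
      ∃ U ∈ decompose w, Contains (chain (vals U)) (chain L) := by
    constructor
    · rintro ⟨s, hs, h⟩
      obtain ⟨w, hw, rfl⟩ := List.mem_map.1 hs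
      obtain ⟨U, hU, rfl⟩ := List.mem_map.1 hw
      exact ⟨U, hU, h⟩
    · rintro ⟨U, hU, h⟩
      exact ⟨_, List.mem_map_of_mem (List.mem_map_of_mem hU), h⟩
  rw [key]
  simp only [contains_chain_chain_iff hL, Avoids, not_exists, not_and, not_or]

theorem finite_length_eq (n : ℕ) : {w : NCPartition | w.1.length = n}.Finite := by
  have h1 := (List.finite_length_eq (Fin (n + 1)) n).image (List.map Fin.val)
  refine (h1.preimage Subtype.val_injective.injOn).subset fun w hw => ?_
  have hb : ∀ x ∈ w.1, x < n + 1 := by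
    intro x hx
    have h2 := w.2.1.le_numBlocks hx
    have h3 : numBlocks w.1 ≤ w.1.length := List.toFinset_card_le _
    have h4 : w.1.length = n := hw
    omega
  refine ⟨w.1.pmap Fin.mk hb, ?_, ?_⟩
  · simpa using hw
  · simp [List.map_pmap]

/-- If a word has a letter containing all of `L`, so does its image, and both words contain `s`.
Otherwise `e` fixes every letter of the word. -/
theorem mapInvariant_containing {L : List (List ℕ)} {s : List ℕ} (hs : s ∈ L)
    {e : Equiv.Perm NCPartition}
    (he : ∀ w : NCPartition, ¬ (∀ t ∈ L, Contains w.1 t) → e w = w) :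
    MapInvariant e (containing s) := by
  intro U
  by_cases h : ∃ w ∈ U, ∀ t ∈ L, Contains w.1 t
  · obtain ⟨w, hw, hc⟩ := h
    have hc' : ∀ t ∈ L, Contains (e w).1 t := by
      by_contra hn
      -- If `e w` missed some pattern, `e` would fix it, and injectivity would give `e w = w`.
      have := e.injective (he (e w) hn)
      rw [this] at hn
      exact hn hc
    have key : ∀ (V : List NCPartition) v, v ∈ V → Contains v.1 s → V ∈ containing s := by
      intro V v hv hvs
      obtain ⟨b, hb⟩ := sublist_of_mem_bracketAll (List.mem_map_of_mem (f := Subtype.val) hv)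
      exact ⟨List.ne_nil_of_mem hv, ((contains_map_add_left b).2 hvs).of_sublist hb⟩
    exact iff_of_true (key _ _ (List.mem_map_of_mem hw) (hc' s hs)) (key _ _ hw (hc s hs))
  · push Not at h
    have : U.map e = U := by
      refine (List.map_congr_left fun w hw => ?_).trans (List.map_id U)
      obtain ⟨t, ht, hc⟩ := h w hw
      exact he w fun h => hc (h t ht)
    rw [this]

/-! Patterns whose occurrences do not depend on the order of the parts. -/

theorem reverse_containing_of_perm {s : List ℕ}
    (h : ∀ I J : List NCPartition, I.Perm J → Contains (bracketAll (vals I)) s →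
      Contains (bracketAll (vals J)) s) : (containing s).reverse = containing s := by
  refine Language.ext fun I => ?_
  rw [Language.mem_reverse, mem_containing, mem_containing]
  exact and_congr (by simp) ⟨h _ _ (List.reverse_perm I), h _ _ (List.reverse_perm I).symm⟩

theorem contains_nil (w : List ℕ) : Contains w [] :=
  contains_iff.2 ⟨id, by simp [StrictMonoOn], by simp⟩

theorem eq_range'_of_nodup {p : List ℕ} (hp : IsPartition p) (hn : p.Nodup) :
    p = List.range' 1 p.length := by
  induction p using List.reverseRecOn with
  | nil => rfl
  | append_singleton p a ih =>
    obtain ⟨hp', h1, h2⟩ := isPartition_snoc.1 hp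
    have hn' := List.nodup_append.1 hn
    have e := ih hp' hn'.1
    have h3 : numBlocks p = p.length := List.toFinset_card_of_nodup hn'.1
    rw [hp'.foldr_max, h3] at h2
    have h4 : a ∉ p := fun h => hn'.2.2 a h a (by simp) rfl
    rw [hp'.mem_iff, h3] at h4
    obtain rfl : a = p.length + 1 := by omega
    rw [List.length_append, List.length_singleton, List.range'_concat, ← e]
    simp [add_comm]

/-- The first occurrences of the letters of a partition appear in increasing order. -/
theorem range'_sublist {w : List ℕ} (hw : IsPartition w) {n : ℕ} (hn : n ≤ numBlocks w) :
    (List.range' 1 n).Sublist w := by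
  induction w using List.reverseRecOn generalizing n with
  | nil =>
    obtain rfl : n = 0 := by simpa [numBlocks] using hn
    simp
  | append_singleton w a ih =>
    obtain ⟨hw', h1, h2⟩ := isPartition_snoc.1 hw
    by_cases h : n ≤ numBlocks w
    · exact (ih hw' h).trans (List.sublist_append_left _ _)
    · rw [← hw.foldr_max, foldr_max_append, hw'.foldr_max] at hn
      rw [hw'.foldr_max] at h2
      simp at hn
      obtain ⟨rfl, rfl⟩ : n = numBlocks w + 1 ∧ a = numBlocks w + 1 := by omega
      rw [List.range'_concat]
      refine (ih hw' le_rfl).append ?_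
      simp [add_comm]

theorem contains_iff_of_nodup {w p : List ℕ} (hw : IsPartition w) (hp : IsPartition p)
    (hn : p.Nodup) : Contains w p ↔ p.length ≤ numBlocks w := by
  constructor
  · intro h
    obtain ⟨g, h1, h2⟩ := contains_iff.1 h
    have h3 : (p.map g).Nodup := (List.nodup_map_iff_inj_on hn).2
      fun x hx y hy e => h1.injOn hx hy e
    have h4 := Finset.card_le_card (fun x hx => List.mem_toFinset.2 (h2.subset (List.mem_toFinset.1 hx)))
    rw [List.toFinset_card_of_nodup h3, List.length_map] at h4
    exact h4
  · intro h
    rw [eq_range'_of_nodup hp hn]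
    exact contains_iff.2 ⟨id, strictMonoOn_id, by simpa using range'_sublist hw h⟩

theorem numBlocks_bracketAll {U : List (List ℕ)} (hU : ∀ s ∈ U, IsPartition s) :
    numBlocks (bracketAll U) = (U.map numBlocks).sum := by
  induction U with
  | nil => rfl
  | cons s U ih =>
    have hU' : ∀ s ∈ U, IsPartition s := fun t ht => hU t (by simp [ht])
    rw [bracketAll_cons s U (hU s (by simp)) hU',
      numBlocks_bracket (hU s (by simp)) (isPartition_bracketAll hU'), ih hU']
    simp

/-- A nonempty connected pattern must occur inside a single letter of the word, and a pattern of
singletons only needs enough blocks in total. Neither condition depends on the order of the letters.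
-/
theorem reverse_containing {s : List ℕ} (hs : IsPartition s) (hn : NonCrossing s)
    (h : s = [] ∨ Connected s ∨ OnlySingletons s) : (containing s).reverse = containing s := by
  refine reverse_containing_of_perm fun I J hIJ hI => ?_
  by_cases h0 : s = []
  · exact h0 ▸ contains_nil _
  rcases h with h | h | h
  · exact absurd h h0
  · obtain ⟨V, -, rfl⟩ := exists_eq_chain hs hn h0 h
    rw [contains_bracketAll_chain V isPartition_of_mem_vals] at hI ⊢
    obtain ⟨w, hw, hw'⟩ := hI
    exact ⟨w, (hIJ.map _).subset hw, hw'⟩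
  · have key : ∀ K : List NCPartition, IsPartition (bracketAll (vals K)) :=
      fun K => isPartition_bracketAll isPartition_of_mem_vals
    rw [contains_iff_of_nodup (key _) hs h, numBlocks_bracketAll isPartition_of_mem_vals] at hI ⊢
    rwa [← ((hIJ.map _).map _).sum_eq]

/-! ### Swapping two adjacent parts of the pattern. -/

theorem ccEquiv_chain_swap {L M : List (List ℕ)} {a b : List ℕ}
    (h : ∀ s ∈ L ++ a :: b :: M, IsPartition s ∧ NonCrossing s)
    (ha : a = [] ∨ Connected a ∨ OnlySingletons a) :
    CCEquiv (chain (L ++ a :: b :: M)) (chain (L ++ b :: a :: M)) := by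
  have hmem : ∀ s, s ∈ L ++ b :: a :: M ↔ s ∈ L ++ a :: b :: M := by
    intro s
    simp
    tauto
  have h' : ∀ s ∈ L ++ b :: a :: M, IsPartition s ∧ NonCrossing s :=
    fun s hs => h s ((hmem s).1 hs)
  have hp := fun s hs => (h s hs).1
  have hp' := fun s hs => (h' s hs).1
  have hinf : ∀ K : List (List ℕ), ∀ p ∈ K.map containing, InfixClosed p := by
    intro K p hp
    obtain ⟨s, -, rfl⟩ := List.mem_map.1 hp
    exact infixClosed_containing s
  have hS : Rearranges (splitting (L ++ a :: b :: M)) (splitting (L ++ b :: a :: M)) := by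
    simp only [splitting, List.map_append, List.map_cons]
    exact rearranges_prod_swap (hinf L) (hinf M) (infixClosed_containing a)
      (infixClosed_containing b)
      (reverse_containing (h a (by simp)).1 (h a (by simp)).2 ha)
  obtain ⟨e, e1, e2, e3⟩ := exists_perm_of_rearranges
    (size := fun w : NCPartition => w.1.length)
    (A := fun w => Avoids w.1 (chain (L ++ a :: b :: M)))
    (A' := fun w => Avoids w.1 (chain (L ++ b :: a :: M)))
    -- A partition missing one of the parts avoids both chains, as required outside `F`.
    (F := fun w => ∀ t ∈ L ++ b :: a :: M, Contains w.1 t)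
    decompose length_eq_sum_decompose finite_length_eq (avoids_chain_iff hp) (avoids_chain_iff hp')
    hS
    (fun w hw hc => hw fun t ht => hc.of_mem_chain ((hmem t).1 ht))
    (fun w hw hc => hw fun t ht => hc.of_mem_chain ht)
    (fun e he => MapInvariant.mul_prod (by
      intro p hp
      obtain ⟨s, hs, rfl⟩ := List.mem_map.1 hp
      exact mapInvariant_containing hs he) (mapInvariant_top e))
  refine ⟨⟨isPartition_chain hp, nonCrossing_chain hp fun s hs => (h s hs).2⟩,
    ⟨isPartition_chain hp', nonCrossing_chain hp' fun s hs => (h' s hs).2⟩, ?_⟩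
  have E : ∀ p : List ℕ, ∃ f : ncAvoiders p ≃ {w : NCPartition // Avoids w.1 p},
      ∀ w, (f w).1.1 = w.1 := fun p =>
    ⟨⟨fun w => ⟨⟨w.1, w.2.1, (nonCrossing_iff _ w.2.1).2 w.2.2.1⟩, w.2.2.2⟩,
      fun w => ⟨w.1.1, w.1.2.1, (nonCrossing_iff _ w.1.2.1).1 w.1.2.2, w.2⟩,
      fun _ => rfl, fun _ => rfl⟩, fun _ => rfl⟩
  obtain ⟨f, hf⟩ := E (chain (L ++ a :: b :: M))
  obtain ⟨f', hf'⟩ := E (chain (L ++ b :: a :: M))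
  refine ⟨(f.trans (e.subtypeEquiv e3)).trans f'.symm, fun w => ?_⟩
  have h1 : ((f'.symm (e.subtypeEquiv e3 (f w))).1 : List ℕ) = (e (f w).1).1 := by
    rw [← hf', Equiv.apply_symm_apply]
    rfl
  have hw : w.1 = (compose (decompose (f w).1)).1 := by rw [compose_decompose, hf]
  have hw' : (f'.symm (e.subtypeEquiv e3 (f w))).1 = (compose (decompose (e (f w).1))).1 := by
    rw [compose_decompose, h1]
  simp only [Equiv.trans_apply]
  refine ⟨by rw [h1, e1, hf], _, _, hw ▸ isComponents_compose _, hw' ▸ isComponents_compose _, ?_⟩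
  simp [e2]

end SetPart

/-- Indices start at `0`, so the swapped parts `σ_q`, `σ_{q+1}` of the statement are those with
indices `q`, `q + 1` here, shifted by one. -/
theorem mainTheorem9 (k : ℕ) (σ : Fin k → List ℕ)
    (hσ : ∀ i, SetPart.IsPartition (σ i) ∧ SetPart.NonCrossing (σ i))
    (q : ℕ) (hq : q + 1 < k)
    (hσq : σ ⟨q, Nat.lt_of_succ_lt hq⟩ = [] ∨
      SetPart.Connected (σ ⟨q, Nat.lt_of_succ_lt hq⟩) ∨
      SetPart.OnlySingletons (σ ⟨q, Nat.lt_of_succ_lt hq⟩)) :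
    SetPart.CCEquiv (SetPart.chain (List.ofFn σ))
      (SetPart.chain (List.ofFn
        (σ ∘ Equiv.swap (⟨q, Nat.lt_of_succ_lt hq⟩ : Fin k) ⟨q + 1, hq⟩))) := by
  have hq' := Nat.lt_of_succ_lt hq
  have e1 : List.ofFn σ = (List.ofFn σ).take q ++
      σ ⟨q, hq'⟩ :: σ ⟨q + 1, hq⟩ :: (List.ofFn σ).drop (q + 2) := by
    conv_lhs => rw [← List.take_append_drop q (List.ofFn σ)]
    rw [List.drop_eq_getElem_cons (by simpa using hq'),
      List.drop_eq_getElem_cons (by simpa using hq)]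
    simp
  have e2 : List.ofFn (σ ∘ Equiv.swap (⟨q, hq'⟩ : Fin k) ⟨q + 1, hq⟩) = (List.ofFn σ).take q ++
      σ ⟨q + 1, hq⟩ :: σ ⟨q, hq'⟩ :: (List.ofFn σ).drop (q + 2) := by
    conv_lhs => rw [← List.take_append_drop q (List.ofFn _)]
    rw [List.drop_eq_getElem_cons (by simpa using hq'),
      List.drop_eq_getElem_cons (by simpa using hq)]
    congr 1
    · refine List.ext_getElem (by simp) fun i h1 h2 => ?_
      simp at h1
      rw [List.getElem_take, List.getElem_take, List.getElem_ofFn, List.getElem_ofFn,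
        Function.comp_apply, Equiv.swap_apply_of_ne_of_ne] <;> simp <;> omega
    · congr 1
      · simp
      congr 1
      · simp
      refine List.ext_getElem (by simp) fun i h1 h2 => ?_
      rw [List.getElem_drop, List.getElem_drop, List.getElem_ofFn, List.getElem_ofFn,
        Function.comp_apply, Equiv.swap_apply_of_ne_of_ne] <;> simp <;> omega
  rw [e2]
  conv => arg 1; rw [e1]
  refine SetPart.ccEquiv_chain_swap (fun s hs => ?_) hσq
  rw [← e1] at hs
  obtain ⟨i, rfl⟩ := (List.mem_ofFn' σ s).1 hs
  exact hσ i
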